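/- Let $N',K'$ be integers and consider a (multicast) index coding problem with $N'$ messages and $K'$ receivers: receiver $j\in[1:K']$ demands the messages indexed by $\mathcal D_j\subseteq[1:N']$ and knows the messages indexed by $\mathcal A_j\subseteq[1:N']$, where $\mathcal D_j\neq\emptyset$, $\mathcal A_j\neq[1:N']$ and $\mathcal D_j\cap\mathcal A_j=\emptyset$. The server is connected to all receivers by a noiseless broadcast link with finite non-empty alphabet $\mathcal X$. A code of block length $n$ for the rate tuple $(R_1,\dots,R_{N'})$ consists of an encoder $\mathrm{enc}$, which maps $(M_1,\dots,M_{N'})$ with $M_i\in[1:\lceil 2^{nR_i}\rceil]$ to $X^n\in\mathcal X^n$, and of decoders $\mathrm{dec}_j$, which map $X^n$ and $(M_i:i\in\mathcal A_j)$ to an estimate of $(M_i:i\in\mathcal D_j)$. Its error probability is $$\epsilon_n=\max_{j\in[1:K']}\Pr\big[\mathrm{dec}_j(X^n,(M_i:i\in\mathcal A_j))\neq(M_i:i\in\mathcal D_j)\big],$$ where the $M_i$ are independent and uniformly distributed. The rate tuple is achievable if there is a sequence of such codes, one for every $n$, with $\lim_{n\to\infty}\epsilon_n=0$. **Theorem.**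 Let $R=(R_1,\dots,R_{N'})$ be a non-negative rate tuple. Suppose that there are independent discrete (finite- or countable-alphabet) random variables $U_1,\dots,U_{N'}$ and, for every $\mathcal P\subseteq[1:N']$, a function $f_{\mathcal P}$ such that, with $X_{\mathcal P}:=f_{\mathcal P}\big((U_i:i\in\mathcal P)\big)$, $$H\big((X_{\mathcal P}:\mathcal P\subseteq[1:N'])\,\big|\,(U_i:i\in\mathcal A_j)\big)\le\log_2|\mathcal X|\qquad\text{for all }j\in[1:K'],$$ and such that for every $j\in[1:K']$ there is a set $\mathcal K_j$ with $\mathcal D_j\subseteq\mathcal K_j\subseteq[1:N']\setminus\mathcal A_j$ satisfying $$\sum_{i\in\mathcal J}R_i<I\big((U_i:i\in\mathcal J)\,;\,(X_{\mathcal P}:\mathcal P\subseteq[1:N'])\,\big|\,(U_i:i\in\mathcal A_j\cup(\mathcal K_j\setminus\mathcal J))\big)$$ for every $\mathcal J\subseteq\mathcal K_j$ with $\mathcal J\cap\mathcal D_j\neq\emptyset$. Then $R$ is achievable. (Entropy and mutual information are measured in bits.) -/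

import Mathlib

open MeasureTheory ProbabilityTheory Filter Topology

namespace IndexCoding

/-- A general (multicast) index coding problem with `N` messages and `K` receivers: receiver `j`
knows the messages indexed by `A j` and demands the messages indexed by `D j`. -/
structure Problem (N K : ℕ) where
  /-- side information sets -/
  A : Fin K → Finset (Fin N)
  /-- demand sets -/
  D : Fin K → Finset (Fin N)
  D_nonempty : ∀ j, (D j).Nonempty
  A_ne_univ : ∀ j, A j ≠ Finset.univ
  disjoint : ∀ j, Disjoint (D j) (A j)

/-- A code of block length `n` over the channel alphabet `𝓧` where message `i` takes values in a
set of size `M i`. -/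
structure Code {N K : ℕ} (P : Problem N K) (𝓧 : Type*) (M : Fin N → ℕ) (n : ℕ) where
  /-- the encoding function -/
  enc : (∀ i, Fin (M i)) → (Fin n → 𝓧)
  /-- the decoding function of each receiver -/
  dec : ∀ j, (Fin n → 𝓧) → (∀ i : {i // i ∈ P.A j}, Fin (M i)) →
    (∀ i : {i // i ∈ P.D j}, Fin (M i))

/-- The probability that receiver `j` is in error. The messages are independent and each is
uniform, that is, the tuple of messages is uniform on the product of the message sets. -/
noncomputable def Code.receiverError {N K : ℕ} {P : Problem N K} {𝓧 : Type*} {M : Fin N → ℕ}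
    {n : ℕ} (c : Code P 𝓧 M n) (j : Fin K) : ℝ :=
  ((Finset.univ.filter fun m : ∀ i, Fin (M i) =>
      c.dec j (c.enc m) (fun i => m i.1) ≠ fun i : {i // i ∈ P.D j} => m i.1).card : ℝ) /
    (Fintype.card (∀ i, Fin (M i)) : ℝ)

/-- The probability of error of a code: the maximum over the receivers. -/
noncomputable def Code.errorProb {N K : ℕ} {P : Problem N K} {𝓧 : Type*} {M : Fin N → ℕ}
    {n : ℕ} (c : Code P 𝓧 M n) : ℝ :=
  ⨆ j, c.receiverError j

/-- The rate tuple `R` (in bits per channel use) is achievable: there are codes, one for each block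
length `n`, with `⌈2 ^ (n R i)⌉` values of message `i`, whose error probabilities tend to `0`. -/
def Achievable {N K : ℕ} (P : Problem N K) (𝓧 : Type*) (R : Fin N → ℝ) : Prop :=
  ∃ c : ∀ n : ℕ, Code P 𝓧 (fun i => ⌈(2 : ℝ) ^ ((n : ℝ) * R i)⌉₊) n,
    Tendsto (fun n => (c n).errorProb) atTop (𝓝 0)

section Information

/-- Conditional entropy `H(X | Y)` in bits of discrete random variables (possibly infinite):
the sum of `p(x,y) log₂ (1 / p(x|y))`, whose terms are all nonnegative. -/
noncomputable def condEntropy {Ω β γ : Type*} [MeasurableSpace Ω] (μ : Measure Ω)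
    (X : Ω → β) (Y : Ω → γ) : ENNReal :=
  ∑' t : β × γ, ENNReal.ofReal
    (μ.real {ω | X ω = t.1 ∧ Y ω = t.2} *
      Real.logb 2 (μ.real {ω | Y ω = t.2} / μ.real {ω | X ω = t.1 ∧ Y ω = t.2}))

/-- Conditional mutual information `I(U ; X | V)` in bits of discrete random variables: the sum of
`p(u,x,v) log₂ (p(u,x|v) / (p(u|v) p(x|v)))`. The negative terms always have a finite sum, so the
series converges absolutely unless the mutual information is infinite; it is finite as soon as
`H(X | V)` is finite. -/
noncomputable def condMutualInfo {Ω α β γ : Type*} [MeasurableSpace Ω] (μ : Measure Ω)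
    (U : Ω → α) (X : Ω → β) (V : Ω → γ) : ℝ :=
  ∑' t : α × β × γ,
    μ.real {ω | U ω = t.1 ∧ X ω = t.2.1 ∧ V ω = t.2.2} *
      Real.logb 2
        (μ.real {ω | U ω = t.1 ∧ X ω = t.2.1 ∧ V ω = t.2.2} * μ.real {ω | V ω = t.2.2} /
          (μ.real {ω | U ω = t.1 ∧ V ω = t.2.2} * μ.real {ω | X ω = t.2.1 ∧ V ω = t.2.2}))

end Information

/-- The tuple `(U i : i ∈ S)` as one random variable. -/
def sub {N : ℕ} {Ω : Type*} {α : Fin N → Type*} (U : ∀ i, Ω → α i) (S : Finset (Fin N)) :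
    Ω → (∀ i : {i // i ∈ S}, α i) :=
  fun ω i => U i ω

/-- The collection of all composite indices `X_S = f_S (U i : i ∈ S)`, for `S` a set of messages,
as one random variable. -/
def composite {N : ℕ} {Ω : Type*} {α : Fin N → Type*} {β : Finset (Fin N) → Type*}
    (U : ∀ i, Ω → α i) (f : ∀ S : Finset (Fin N), (∀ i : {i // i ∈ S}, α i) → β S) :
    Ω → (∀ S, β S) :=
  fun ω S => f S (sub U S ω)

end IndexCoding

/-! The proof is composite coding with all composites merged into one function `F` of the letters.
Codewords are drawn i.i.d. with the laws of the `U i`. A message tuple then determines a sequence of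
`l` values of `F`, and only a hash of this sequence into `𝓧^n` is sent. Receiver `j` looks for a
sequence with the received hash that is typical given its side information, together with a message
tuple that is jointly typical with it.

Three things can go wrong. The true pair may be atypical, which the law of large numbers for
log-posteriors and log-likelihood ratios excludes (`tendsto_infinitePi_prod_lt`). A tuple wrong
exactly on `J ⊆ L j` may pass: its codewords on `J` are fresh, so the likelihood ratio has mean at
most 1, and Markov's inequality beats the roughly `2^(n ∑ R)` candidates (`codebookLaw_wrong_le`).
Another typical sequence may share the hash: posteriors sum to at most 1, so there are few such
sequences compared with `|𝓧|^n` (`card_posterior_le`, `exists_hash_of_card_le`).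

Typicality is a one-sided threshold on a likelihood, so countable alphabets need only integrability
of the logarithms. The choice `l ≈ (1 - δ) n` makes room for an entropy bound that holds with
equality, and the strict information bounds survive a small `δ`. When `|𝓧| = 1` there is no such
room, but then the hypotheses contradict each other unless there are no receivers. -/

namespace IndexCoding

/-! ### Laws of large numbers, change of measure and counting bounds. -/

section Probability

/-- The weak law of large numbers for the i.i.d. sequence with common law `p`, as an upper tail
bound. -/
theorem tendsto_infinitePi_sum_ge {A : Type*} [MeasurableSpace A] (p : Measure A)
    [IsProbabilityMeasure p] {g : A → ℝ} (hg : Measurable g) (hint : Integrable g p) {c : ℝ}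
    (hc : ∫ a, g a ∂p < c) :
    Tendsto (fun l : ℕ => (Measure.infinitePi fun _ : Fin l => p)
      {a | (l : ℝ) * c ≤ ∑ t, g (a t)}) atTop (𝓝 0) := by
  -- The space depends on `l`; all these spaces are images of one space of infinite sequences, where
  -- the strong law gives convergence in measure.
  set Q : Measure (ℕ → A) := Measure.infinitePi fun _ : ℕ => p with hQ
  have hind : iIndepFun (fun (i : ℕ) (ω : ℕ → A) => g (ω i)) Q :=
    iIndepFun_infinitePi (X := fun _ : ℕ => g) fun _ => hg
  have hpres (i : ℕ) : Measure.map (fun ω : ℕ → A => ω i) Q = p :=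
    Measure.infinitePi_map_eval (fun _ : ℕ => p) i
  have hmap (i : ℕ) : Measure.map (fun ω : ℕ → A => g (ω i)) Q = Measure.map g p := by
    rw [← hpres i, Measure.map_map hg (measurable_pi_apply i)]
    rfl
  have hlaw := strong_law_ae_real (μ := Q) (fun i ω => g (ω i))
    (by
      have : Integrable g (Measure.map (fun ω : ℕ → A => ω 0) Q) := by rwa [hpres]
      exact this.comp_measurable (measurable_pi_apply 0))
    (fun i j hij => hind.indepFun hij)
    (fun i => ⟨(hg.comp (measurable_pi_apply i)).aemeasurable,
      (hg.comp (measurable_pi_apply 0)).aemeasurable, by rw [hmap, hmap]⟩)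
  have hmean : ∫ ω, g (ω 0) ∂Q = ∫ a, g a ∂p := by
    conv_rhs => rw [← hpres 0]
    rw [integral_map (measurable_pi_apply 0).aemeasurable
      (by rw [hpres]; exact hint.aestronglyMeasurable)]
  have hm := tendstoInMeasure_of_tendsto_ae (μ := Q)
    (f := fun (n : ℕ) ω => (∑ i ∈ Finset.range n, g (ω i)) / n) (g := fun _ => ∫ ω, g (ω 0) ∂Q)
    (fun n => by
      apply Measurable.aestronglyMeasurable
      fun_prop) hlaw
  have h0 := hm (ENNReal.ofReal (c - ∫ a, g a ∂p)) (by simpa using hc)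
  refine tendsto_of_tendsto_of_tendsto_of_le_of_le' tendsto_const_nhds h0 (by simp) ?_
  filter_upwards [eventually_gt_atTop 0] with l hl
  have hl' : (0 : ℝ) < l := by exact_mod_cast hl
  rw [← Measure.map_infinitePi_infinitePi_of_inj (P := fun _ : ℕ => p) (f := (Fin.val : Fin l → ℕ))
    Fin.val_injective, Measure.map_apply (by fun_prop)
      (measurableSet_le measurable_const (by fun_prop))]
  refine measure_mono fun ω hω => ?_
  simp only [Set.preimage_ofPred_eq, Set.mem_ofPred_eq] at hω ⊢
  rw [edist_dist, Real.dist_eq]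
  apply ENNReal.ofReal_le_ofReal
  refine le_trans ?_ (le_abs_self _)
  rw [hmean]
  gcongr
  rw [le_div_iff₀ hl', mul_comm, Finset.sum_range]
  exact hω

/-- Markov's inequality for a product of independent nonnegative random variables of mean at most
`1`. -/
theorem infinitePi_prod_ge_le {A : Type*} [MeasurableSpace A] (p : Measure A)
    [IsProbabilityMeasure p] {φ : A → ℝ} (hφ : Measurable φ) (hφ0 : ∀ a, 0 ≤ φ a)
    (hint : ∫⁻ a, ENNReal.ofReal (φ a) ∂p ≤ 1) (l : ℕ) {T : ℝ} (hT : 0 < T) :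
    (Measure.infinitePi fun _ : Fin l => p) {a | T ≤ ∏ t, φ (a t)} ≤ ENNReal.ofReal T⁻¹ := by
  set Q : Measure (Fin l → A) := Measure.infinitePi fun _ : Fin l => p
  have hind : iIndepFun (fun (i : Fin l) (ω : Fin l → A) => ENNReal.ofReal (φ (ω i))) Q :=
    iIndepFun_infinitePi (X := fun _ : Fin l => fun a => ENNReal.ofReal (φ a))
      fun _ => hφ.ennreal_ofReal
  have hprod : ∫⁻ ω, ∏ i, ENNReal.ofReal (φ (ω i)) ∂Q ≤ 1 := by
    rw [lintegral_prod_eq_prod_lintegral_of_indepFun _ _ hind (fun i => by fun_prop)]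
    refine Finset.prod_le_one' fun i _ => ?_
    have hpres : Measure.map (fun ω : Fin l → A => ω i) Q = p :=
      Measure.infinitePi_map_eval (fun _ : Fin l => p) i
    rw [← hpres, lintegral_map (by fun_prop) (by fun_prop)] at hint
    exact hint
  have hmk := mul_meas_ge_le_lintegral (μ := Q)
    (f := fun ω => ∏ i, ENNReal.ofReal (φ (ω i))) (by fun_prop) (ENNReal.ofReal T)
  have hset : {a : Fin l → A | T ≤ ∏ t, φ (a t)}
      = {a | ENNReal.ofReal T ≤ ∏ i, ENNReal.ofReal (φ (a i))} := by
    ext a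
    rw [Set.mem_ofPred_eq, Set.mem_ofPred_eq, ← ENNReal.ofReal_prod_of_nonneg fun i _ => hφ0 _,
      ENNReal.ofReal_le_ofReal_iff (Finset.prod_nonneg fun i _ => hφ0 _)]
  rw [hset, ENNReal.ofReal_inv_of_pos hT, ENNReal.le_inv_iff_mul_le, mul_comm]
  exact hmk.trans hprod

/-- Change of measure: the ratio of a joint law to the product of the laws of two independent
variables has mean at most `1`. -/
theorem lintegral_ratio_le_one {Ω A B : Type*} [MeasurableSpace Ω] [MeasurableSpace A]
    [MeasurableSpace B] [Countable A] [Countable B] [MeasurableSingletonClass A]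
    [MeasurableSingletonClass B] (P : Measure Ω) [IsProbabilityMeasure P]
    {X : Ω → A} {Y : Ω → B} (hX : Measurable X) (hY : Measurable Y) (hXY : IndepFun X Y P)
    (q : Measure (A × B)) [IsProbabilityMeasure q] :
    ∫⁻ ω, ENNReal.ofReal (q.real {(X ω, Y ω)} /
      (P.real {ω' | X ω' = X ω} * P.real {ω' | Y ω' = Y ω})) ∂P ≤ 1 := by
  have hlaw := (indepFun_iff_map_prod_eq_prod_map_map hX.aemeasurable hY.aemeasurable).1 hXY
  have h1 : ∫⁻ ω, ENNReal.ofReal (q.real {(X ω, Y ω)} /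
      (P.real {ω' | X ω' = X ω} * P.real {ω' | Y ω' = Y ω})) ∂P =
      ∫⁻ z, ENNReal.ofReal (q.real {z} /
        (P.real {ω' | X ω' = z.1} * P.real {ω' | Y ω' = z.2})) ∂(P.map fun ω => (X ω, Y ω)) := by
    rw [lintegral_map (measurable_of_countable _) (by fun_prop)]
  rw [h1, hlaw, lintegral_countable']
  -- The product law cancels the denominator; where the denominator vanishes the term is zero, hence
  -- only an inequality.
  have h2 (z : A × B) : ENNReal.ofReal (q.real {z} /
        (P.real {ω' | X ω' = z.1} * P.real {ω' | Y ω' = z.2})) *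
        ((P.map X).prod (P.map Y)) {z} ≤ q {z} := by
    obtain ⟨x, y⟩ := z
    rw [← Set.singleton_prod_singleton, Measure.prod_prod, Measure.map_apply hX (by simp),
      Measure.map_apply hY (by simp), Set.singleton_prod_singleton]
    change _ * (P {ω' | X ω' = x} * P {ω' | Y ω' = y}) ≤ _
    rw [← ofReal_measureReal (μ := P), ← ofReal_measureReal (μ := P),
      ← ofReal_measureReal (μ := q), ← ENNReal.ofReal_mul (by positivity),
      ← ENNReal.ofReal_mul (by positivity)]
    apply ENNReal.ofReal_le_ofReal
    rcases eq_or_ne (P.real {ω' | X ω' = x} * P.real {ω' | Y ω' = y}) 0 with h0 | h0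
    · simp [h0]
    · rw [div_mul_cancel₀ _ h0]
  calc _ ≤ ∑' z, q {z} := ENNReal.tsum_le_tsum h2
    _ = ∫⁻ _, 1 ∂q := by simp [lintegral_countable']
    _ = 1 := by simp

/-- A set of sequences each of which has probability at least `c` under a product of sub-probability
measures has at most `1 / c` elements. -/
theorem card_mul_le_one_of_le_prod {B : Type*} [MeasurableSpace B] [MeasurableSingletonClass B]
    {l : ℕ} (m : Fin l → Measure B) [∀ t, IsFiniteMeasure (m t)] (hm : ∀ t, m t Set.univ ≤ 1)
    (S : Finset (Fin l → B)) {c : ℝ} (hS : ∀ x ∈ S, c ≤ ∏ t, (m t).real {x t}) :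
    (S.card : ℝ) * c ≤ 1 := by
  have h1 : (S.card : ℝ) * c ≤ ∑ x ∈ S, (Measure.pi m).real {x} := by
    rw [← nsmul_eq_mul]
    refine Finset.card_nsmul_le_sum _ _ _ fun x hx => (hS x hx).trans_eq ?_
    rw [measureReal_def, Measure.pi_singleton, ENNReal.toReal_prod]
    rfl
  refine h1.trans ?_
  rw [sum_measureReal_singleton]
  refine (measureReal_mono (Set.subset_univ _)).trans ?_
  rw [measureReal_def, Measure.pi_univ]
  refine ENNReal.toReal_le_of_le_ofReal zero_le_one ?_
  rw [ENNReal.ofReal_one]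
  exact Finset.prod_le_one' fun t _ => hm t

/-- A series over the values of a random variable on a countable space as an expectation. -/
theorem integrable_and_integral_eq_tsum {A τ : Type*} [MeasurableSpace A] [Countable A]
    [MeasurableSingletonClass A] (p : Measure A) [IsProbabilityMeasure p] (T : A → τ) (Φ : τ → ℝ)
    (h : Summable fun t => p.real {a | T a = t} * Φ t) :
    Integrable (fun a => Φ (T a)) p ∧
      ∫ a, Φ (T a) ∂p = ∑' t, p.real {a | T a = t} * Φ t := by
  -- `τ` may be uncountable, but only the countable range of `T` carries mass.
  let _ : MeasurableSpace (Set.range T) := ⊤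
  have : MeasurableSingletonClass (Set.range T) := ⟨fun _ => trivial⟩
  have hc : Countable (Set.range T) := (Set.countable_range T).to_subtype
  set T' : A → Set.range T := Set.rangeFactorization T with hT'
  have hT'm : Measurable T' := measurable_of_countable _
  have hp : IsProbabilityMeasure (p.map T') := Measure.isProbabilityMeasure_map hT'm.aemeasurable
  have hreal (t : Set.range T) : (p.map T').real {t} = p.real {a | T a = t} := by
    rw [map_measureReal_apply hT'm (by simp)]
    congr 1
    ext a
    simp [hT', Set.rangeFactorization, Subtype.ext_iff]
  have hsupp : Function.support (fun t => p.real {a | T a = t} * Φ t) ⊆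
      Set.range (Subtype.val : Set.range T → τ) := by
    intro t ht
    rw [Subtype.range_coe]
    by_contra hn
    apply ht
    have : {a | T a = t} = ∅ := by
      ext a
      simpa using fun h => hn ⟨a, h⟩
    simp [this]
  have hsum : Summable fun t : Set.range T => (p.map T').real {t} * Φ t := by
    simp_rw [hreal]
    exact h.comp_injective Subtype.val_injective
  have hint : Integrable (fun t : Set.range T => Φ t) (p.map T') := by
    rw [← Measure.sum_smul_dirac (p.map T')]
    refine integrable_sum_dirac (fun t => measure_ne_top _ _) ?_
    refine hsum.norm.congr fun t => ?_
    rw [norm_mul, Real.norm_of_nonneg measureReal_nonneg]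
    rfl
  refine ⟨hint.comp_measurable hT'm, ?_⟩
  have h2 : ∫ a, Φ (T a) ∂p = ∫ t, Φ (t : τ) ∂(p.map T') := by
    rw [integral_map hT'm.aemeasurable hint.aestronglyMeasurable]
    rfl
  rw [h2, integral_countable hint, ← Function.Injective.tsum_eq Subtype.val_injective hsupp]
  exact tsum_congr fun t => by rw [hreal, smul_eq_mul]

end Probability

/-! ### Derandomisation and random hashing. -/

section Hashing

/-- The probabilistic method: some outcome lies in at most the expected number of a finite family
of events. -/
theorem exists_card_filter_le_sum_measureReal {Ω R : Type*} [MeasurableSpace Ω] (Q : Measure Ω)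
    [IsProbabilityMeasure Q] (S : Finset R) (E : R → Set Ω) (hE : ∀ r, MeasurableSet (E r)) :
    ∃ ω, ∀ [DecidablePred fun r => ω ∈ E r],
      ((S.filter fun r => ω ∈ E r).card : ℝ) ≤ ∑ r ∈ S, Q.real (E r) := by
  classical
  have hint (r : R) : Integrable (Set.indicator (E r) (1 : Ω → ℝ)) Q :=
    (integrable_const (1 : ℝ)).indicator (hE r)
  obtain ⟨ω, h⟩ := exists_le_integral (μ := Q)
    (f := fun ω => ∑ r ∈ S, Set.indicator (E r) (1 : Ω → ℝ) ω)
    (integrable_finsetSum _ fun r _ => hint r)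
  refine ⟨ω, fun {_} => ?_⟩
  have hcard : ((S.filter fun r => ω ∈ E r).card : ℝ) =
      ∑ r ∈ S, Set.indicator (E r) (1 : Ω → ℝ) ω := by
    simp [Set.indicator_apply]
  refine hcard.trans_le (h.trans_eq ?_)
  rw [integral_finsetSum _ fun r _ => hint r]
  exact Finset.sum_congr rfl fun r _ => integral_indicator_one (hE r)

/-- A finite family of pairs of distinct keys has a hash function under which the fraction of
colliding pairs is at most the inverse of the number of hash values. -/
theorem exists_hash {ι Y R : Type*} [Fintype Y] [Nonempty Y] [DecidableEq Y]
    (S : Finset R) (a b : R → ι) (hab : ∀ r ∈ S, a r ≠ b r) :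
    ∃ h : ι → Y, ((S.filter fun r => h (a r) = h (b r)).card : ℝ) ≤ S.card / Fintype.card Y := by
  let _ : MeasurableSpace Y := ⊤
  have : MeasurableSingletonClass Y := ⟨fun _ => trivial⟩
  set u : Measure Y := (PMF.uniformOfFintype Y).toMeasure with hu
  set Q : Measure (ι → Y) := Measure.infinitePi fun _ : ι => u
  have hmeas (r : R) : MeasurableSet {h : ι → Y | h (a r) = h (b r)} :=
    measurableSet_eq_fun (measurable_pi_apply _) (measurable_pi_apply _)
  -- Distinct coordinates of a uniformly random function are independent and uniform.
  have hprob (r : R) (hr : r ∈ S) :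
      Q.real {h : ι → Y | h (a r) = h (b r)} = (Fintype.card Y : ℝ)⁻¹ := by
    have hd : MeasurableSet {z : Y × Y | z.1 = z.2} := Set.Countable.measurableSet
      (Set.to_countable _)
    have h1 : {h : ι → Y | h (a r) = h (b r)} =
        (fun h : ι → Y => (h (a r), h (b r))) ⁻¹' {z | z.1 = z.2} := rfl
    rw [measureReal_def, h1, ← Measure.map_apply (by fun_prop) hd,
      Measure.infinitePi_map_eval_prod (hab r hr), Measure.prod_apply hd]
    have h2 (y : Y) : u (Prod.mk y ⁻¹' {z : Y × Y | z.1 = z.2}) = (Fintype.card Y : ENNReal)⁻¹ := by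
      have : Prod.mk y ⁻¹' {z : Y × Y | z.1 = z.2} = {y} := by
        ext z
        simp [eq_comm]
      rw [this, hu, PMF.toMeasure_apply_singleton _ _ (by simp)]
      simp
    simp_rw [h2]
    simp
  obtain ⟨h, hh⟩ := exists_card_filter_le_sum_measureReal Q S
    (fun r => {h : ι → Y | h (a r) = h (b r)}) hmeas
  classical
  refine ⟨h, le_trans (le_of_eq ?_) (hh.trans_eq ?_)⟩
  · simp only [Set.mem_ofPred_eq]
  · rw [Finset.sum_congr rfl hprob, Finset.sum_const, nsmul_eq_mul, div_eq_mul_inv]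

end Hashing

/-! ### Single-letter posteriors and likelihood ratios. -/

section Letters

variable {N : ℕ} {α : Fin N → Type*} [∀ i, MeasurableSpace (α i)] {B : Type*}

/-- The probability that the letters indexed by `V` agree with those of `b`. -/
noncomputable def letterProb (p : Measure (∀ i, α i)) (V : Finset (Fin N)) (b : ∀ i, α i) : ℝ :=
  p.real {a | ∀ i ∈ V, a i = b i}

/-- The probability that the letters indexed by `V` agree with those of `b` and that the function
`F` of all letters takes the value `x`. -/
noncomputable def valueProb (p : Measure (∀ i, α i)) (F : (∀ i, α i) → B) (V : Finset (Fin N))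
    (b : ∀ i, α i) (x : B) : ℝ :=
  p.real {a | F a = x ∧ ∀ i ∈ V, a i = b i}

/-- The conditional probability of the value `x` of `F` given the letters of `b` indexed by `V`. -/
noncomputable def posterior (p : Measure (∀ i, α i)) (F : (∀ i, α i) → B) (V : Finset (Fin N))
    (b : ∀ i, α i) (x : B) : ℝ :=
  valueProb p F V b x / letterProb p V b

/-- The likelihood ratio between the letters indexed by `J` and the pair of the value `x` of `F`
and the letters indexed by `V`. -/
noncomputable def likelihoodRatio (p : Measure (∀ i, α i)) (F : (∀ i, α i) → B)
    (J V : Finset (Fin N)) (b : ∀ i, α i) (x : B) : ℝ :=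
  valueProb p F (J ∪ V) b x / (letterProb p J b * valueProb p F V b x)

variable (p : Measure (∀ i, α i)) (F : (∀ i, α i) → B)

theorem letterProb_congr {V : Finset (Fin N)} {b b' : ∀ i, α i} (h : ∀ i ∈ V, b i = b' i) :
    letterProb p V b = letterProb p V b' := by
  unfold letterProb
  congr 1
  ext a
  exact forall₂_congr fun i hi => by rw [h i hi]

theorem valueProb_congr {V : Finset (Fin N)} {b b' : ∀ i, α i} (h : ∀ i ∈ V, b i = b' i) (x : B) :
    valueProb p F V b x = valueProb p F V b' x := by
  unfold valueProb
  congr 1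
  ext a
  exact and_congr Iff.rfl (forall₂_congr fun i hi => by rw [h i hi])

theorem posterior_congr {V : Finset (Fin N)} {b b' : ∀ i, α i} (h : ∀ i ∈ V, b i = b' i) (x : B) :
    posterior p F V b x = posterior p F V b' x := by
  rw [posterior, posterior, valueProb_congr p F h, letterProb_congr p h]

theorem likelihoodRatio_congr {J V : Finset (Fin N)} {b b' : ∀ i, α i}
    (h : ∀ i ∈ J ∪ V, b i = b' i) (x : B) :
    likelihoodRatio p F J V b x = likelihoodRatio p F J V b' x := by
  rw [likelihoodRatio, likelihoodRatio, valueProb_congr p F h,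
    letterProb_congr p fun i hi => h i (Finset.mem_union_left _ hi),
    valueProb_congr p F fun i hi => h i (Finset.mem_union_right _ hi)]

theorem letterProb_nonneg (V : Finset (Fin N)) (b : ∀ i, α i) : 0 ≤ letterProb p V b :=
  measureReal_nonneg

theorem valueProb_nonneg (V : Finset (Fin N)) (b : ∀ i, α i) (x : B) : 0 ≤ valueProb p F V b x :=
  measureReal_nonneg

theorem posterior_nonneg (V : Finset (Fin N)) (b : ∀ i, α i) (x : B) : 0 ≤ posterior p F V b x :=
  div_nonneg (valueProb_nonneg ..) (letterProb_nonneg ..)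

theorem likelihoodRatio_nonneg (J V : Finset (Fin N)) (b : ∀ i, α i) (x : B) :
    0 ≤ likelihoodRatio p F J V b x :=
  div_nonneg (valueProb_nonneg ..) (mul_nonneg (letterProb_nonneg ..) (valueProb_nonneg ..))

variable [IsProbabilityMeasure p]

theorem valueProb_pos {a : ∀ i, α i} (ha : p {a} ≠ 0) (V : Finset (Fin N)) :
    0 < valueProb p F V a (F a) :=
  (ENNReal.toReal_pos ha (measure_ne_top _ _)).trans_le (measureReal_mono (by simp))

theorem letterProb_pos {a : ∀ i, α i} (ha : p {a} ≠ 0) (V : Finset (Fin N)) :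
    0 < letterProb p V a :=
  (ENNReal.toReal_pos ha (measure_ne_top _ _)).trans_le (measureReal_mono (by simp))

theorem posterior_pos {a : ∀ i, α i} (ha : p {a} ≠ 0) (V : Finset (Fin N)) :
    0 < posterior p F V a (F a) :=
  div_pos (valueProb_pos p F ha V) (letterProb_pos p ha V)

theorem likelihoodRatio_pos {a : ∀ i, α i} (ha : p {a} ≠ 0) (J V : Finset (Fin N)) :
    0 < likelihoodRatio p F J V a (F a) :=
  div_pos (valueProb_pos p F ha _) (mul_pos (letterProb_pos p ha J) (valueProb_pos p F ha V))

variable [∀ i, Countable (α i)] [∀ i, MeasurableSingletonClass (α i)]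

/-- For a function that is almost surely positive, the product over an i.i.d. sequence is typically
at least its exponential growth rate. -/
theorem tendsto_infinitePi_prod_lt {φ : (∀ i, α i) → ℝ} (hφ : ∀ a, p {a} ≠ 0 → 0 < φ a)
    (hint : Integrable (fun a => Real.logb 2 (φ a)) p) {c : ℝ}
    (hc : c < ∫ a, Real.logb 2 (φ a) ∂p) :
    Tendsto (fun l : ℕ => (Measure.infinitePi fun _ : Fin l => p).real
      {w | ¬ (2 : ℝ) ^ ((l : ℝ) * c) ≤ ∏ t, φ (w t)}) atTop (𝓝 0) := by
  have h1 := tendsto_infinitePi_sum_ge p (g := fun a => -Real.logb 2 (φ a))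
    (measurable_of_countable _) hint.neg (c := -c) (by rw [integral_neg]; linarith)
  have h2 := (ENNReal.tendsto_toReal ENNReal.zero_ne_top).comp h1
  refine squeeze_zero (fun l => measureReal_nonneg) (fun l => ?_) h2
  refine ENNReal.toReal_mono (measure_ne_top _ _) (measure_mono_ae ?_)
  have hae : ∀ᵐ w ∂(Measure.infinitePi fun _ : Fin l => p), ∀ t, 0 < φ (w t) := by
    rw [ae_all_iff]
    intro t
    have h3 : ∀ᵐ a ∂p, 0 < φ a := ae_iff_of_countable.2 hφ
    exact (measurePreserving_eval_infinitePi (fun _ : Fin l => p) t).quasiMeasurePreserving.ae h3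
  filter_upwards [hae] with w hw hlt
  have hlt' : ∏ t, φ (w t) < (2 : ℝ) ^ ((l : ℝ) * c) := not_le.1 hlt
  have hlog : Real.logb 2 (∏ t, φ (w t)) < l * c := by
    rw [Real.logb_lt_iff_lt_rpow one_lt_two (Finset.prod_pos fun t _ => hw t)]
    exact hlt'
  rw [Real.logb_prod _ _ fun t _ => (hw t).ne'] at hlog
  change (l : ℝ) * -c ≤ ∑ t, -Real.logb 2 (φ (w t))
  rw [Finset.sum_neg_distrib]
  linarith

end Letters

/-! ### Random codebooks and the two typicality estimates. -/

section Codebook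

variable {N : ℕ} {α : Fin N → Type*} [∀ i, MeasurableSpace (α i)]
  (ν : ∀ i, Measure (α i)) [∀ i, IsProbabilityMeasure (ν i)]
  {B : Type*} (F : (∀ i, α i) → B) {M : Fin N → ℕ}

/-- The law of a random codebook of block length `l`: independent letters, where the letters of the
codewords of message `i` have law `ν i`. -/
noncomputable def codebookLaw (M : Fin N → ℕ) (l : ℕ) :
    Measure (Fin l → ∀ k : (i : Fin N) × Fin (M i), α k.1) :=
  Measure.infinitePi fun _ => Measure.infinitePi fun k => ν k.1

instance (l : ℕ) : IsProbabilityMeasure (codebookLaw ν M l) := by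
  unfold codebookLaw
  infer_instance

/-- The letters of the codewords of the message tuple `m` in the codebook `c`. -/
def codewords {l : ℕ} (c : Fin l → ∀ k : (i : Fin N) × Fin (M i), α k.1) (m : ∀ i, Fin (M i)) :
    Fin l → ∀ i, α i :=
  fun t i => c t ⟨i, m i⟩

theorem codewords_congr {α : Fin N → Type*} {l : ℕ} (c : Fin l → ∀ k : (i : Fin N) × Fin (M i), α k.1)
    {m m' : ∀ i, Fin (M i)} {i : Fin N} (h : m i = m' i) (t : Fin l) :
    codewords c m t i = codewords c m' t i := by
  unfold codewords
  rw [h]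

theorem map_select_eq (m : ∀ i, Fin (M i)) :
    (Measure.infinitePi fun k : (i : Fin N) × Fin (M i) => ν k.1).map (fun c i => c ⟨i, m i⟩) =
      Measure.infinitePi ν :=
  Measure.map_infinitePi_infinitePi_of_inj (P := fun k : (i : Fin N) × Fin (M i) => ν k.1)
    (f := fun i => ⟨i, m i⟩) fun _ _ h => congrArg Sigma.fst h

theorem map_codewords_eq (l : ℕ) (m : ∀ i, Fin (M i)) :
    (codebookLaw ν M l).map (fun c => codewords c m) =
      Measure.infinitePi fun _ : Fin l => Measure.infinitePi ν := by
  unfold codebookLaw codewords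
  rw [Measure.infinitePi_map_pi
    (f := fun (_ : Fin l) (c : ∀ k : (i : Fin N) × Fin (M i), α k.1) i => c ⟨i, m i⟩) _
    (fun _ => by fun_prop)]
  simp_rw [map_select_eq]

variable [∀ i, Countable (α i)] [∀ i, MeasurableSingletonClass (α i)]

/-- The likelihood ratio of fresh letters on `J` has mean at most `1`. -/
theorem lintegral_likelihoodRatio_le_one [Countable B] (m m' : ∀ i, Fin (M i))
    {J V : Finset (Fin N)} (hV : ∀ i ∈ V, m' i = m i) (hJ : ∀ i ∈ J, m' i ≠ m i) :
    ∫⁻ c, ENNReal.ofReal (likelihoodRatio (Measure.infinitePi ν) F J V (fun i => c ⟨i, m' i⟩)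
      (F fun i => c ⟨i, m i⟩)) ∂(Measure.infinitePi fun k : (i : Fin N) × Fin (M i) => ν k.1)
      ≤ 1 := by
  let _ : MeasurableSpace B := ⊤
  have : MeasurableSingletonClass B := ⟨fun _ => trivial⟩
  set p := Measure.infinitePi ν with hp
  set Q := Measure.infinitePi fun k : (i : Fin N) × Fin (M i) => ν k.1 with hQ
  set X : (∀ k : (i : Fin N) × Fin (M i), α k.1) → ∀ i : J, α i := fun c i => c ⟨i, m' i⟩ with hX
  set Y : (∀ k : (i : Fin N) × Fin (M i), α k.1) → B × ∀ i : V, α i :=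
    fun c => (F fun i => c ⟨i, m i⟩, fun i => c ⟨i, m i⟩) with hY
  have hXm : Measurable X := measurable_of_countable _
  have hYm : Measurable Y := measurable_of_countable _
  -- As `m'` differs from `m` on all of `J`, the codewords read by `X` are disjoint from those of
  -- `m`, which are all that `Y` reads.
  have hind : IndepFun X Y Q := by
    have h0 : iIndepFun (fun (k : (i : Fin N) × Fin (M i))
        (c : ∀ k : (i : Fin N) × Fin (M i), α k.1) => c k) Q :=
      iIndepFun_infinitePi (X := fun k x => x) fun k => measurable_id
    have h1 := h0.indepFun_finset (J.image fun i => ⟨i, m' i⟩)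
      (Finset.univ.image fun i => ⟨i, m i⟩)
      (by
        rw [Finset.disjoint_left]
        intro k hk hk'
        obtain ⟨i, hi, rfl⟩ := Finset.mem_image.1 hk
        obtain ⟨i', -, h⟩ := Finset.mem_image.1 hk'
        obtain ⟨rfl, h⟩ := Sigma.mk.inj_iff.1 h
        exact hJ _ hi (eq_of_heq h).symm)
      fun k => measurable_pi_apply k
    exact h1.comp (φ := fun z (i : J) => z ⟨⟨i, m' i⟩, Finset.mem_image_of_mem _ i.2⟩)
      (ψ := fun z => (F fun i => z ⟨⟨i, m i⟩, Finset.mem_image_of_mem _ (Finset.mem_univ _)⟩,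
        fun i : V => z ⟨⟨i, m i⟩, Finset.mem_image_of_mem _ (Finset.mem_univ _)⟩))
      (measurable_of_countable _) (measurable_of_countable _)
  -- The law of this triple is the numerator of the likelihood ratio, as if the letters on `J` were
  -- the true ones.
  set Z : (∀ i, α i) → (∀ i : J, α i) × B × ∀ i : V, α i :=
    fun a => (fun i => a i, F a, fun i => a i) with hZ
  have hZm : Measurable Z := measurable_of_countable _
  have := Measure.isProbabilityMeasure_map (μ := p) hZm.aemeasurable
  refine le_trans (le_of_eq (lintegral_congr fun c => ?_))
    (lintegral_ratio_le_one Q hXm hYm hind (p.map Z))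
  have e1 : (p.map Z).real {(X c, Y c)} =
      valueProb p F (J ∪ V) (fun i => c ⟨i, m' i⟩) (F fun i => c ⟨i, m i⟩) := by
    rw [map_measureReal_apply hZm (by simp), valueProb]
    congr 1
    ext a
    simp only [hX, hY, hZ, Set.mem_preimage, Set.mem_singleton_iff, Prod.mk.injEq, funext_iff,
      Subtype.forall, Set.mem_ofPred_eq, Finset.mem_union]
    constructor
    · rintro ⟨h1, h2, h3⟩
      exact ⟨h2, fun i hi => hi.elim (h1 i) fun hi => by rw [h3 i hi, hV i hi]⟩
    · rintro ⟨h1, h2⟩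
      exact ⟨fun i hi => h2 i (Or.inl hi), h1, fun i hi => by rw [h2 i (Or.inr hi), hV i hi]⟩
  have e2 : Q.real {c' | X c' = X c} = letterProb p J (fun i => c ⟨i, m' i⟩) := by
    rw [letterProb, hp, ← map_select_eq ν m', map_measureReal_apply (by fun_prop)
      (Set.to_countable _).measurableSet]
    congr 1
    ext c'
    simp [hX, funext_iff]
  have e3 : Q.real {c' | Y c' = Y c} =
      valueProb p F V (fun i => c ⟨i, m' i⟩) (F fun i => c ⟨i, m i⟩) := by
    rw [valueProb, hp, ← map_select_eq ν m, map_measureReal_apply (by fun_prop)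
      (Set.to_countable _).measurableSet]
    congr 1
    ext c'
    simp only [hY, Prod.mk.injEq, funext_iff, Subtype.forall, Set.mem_ofPred_eq, Set.mem_preimage]
    exact and_congr Iff.rfl (forall₂_congr fun i hi => by rw [hV i hi])
  rw [likelihoodRatio, e1, e2, e3]

/-- A wrong message tuple passes the likelihood test with small probability. -/
theorem codebookLaw_likelihoodRatio_ge_le [Countable B] (l : ℕ) (m m' : ∀ i, Fin (M i))
    {J V : Finset (Fin N)} (hV : ∀ i ∈ V, m' i = m i) (hJ : ∀ i ∈ J, m' i ≠ m i) {T : ℝ}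
    (hT : 0 < T) :
    (codebookLaw ν M l).real {c | T ≤ ∏ t, likelihoodRatio (Measure.infinitePi ν) F J V
      (codewords c m' t) (F (codewords c m t))} ≤ T⁻¹ := by
  have h := infinitePi_prod_ge_le (Measure.infinitePi fun k : (i : Fin N) × Fin (M i) => ν k.1)
    (φ := fun c => likelihoodRatio (Measure.infinitePi ν) F J V (fun i => c ⟨i, m' i⟩)
      (F fun i => c ⟨i, m i⟩)) (measurable_of_countable _)
    (fun _ => likelihoodRatio_nonneg ..) (lintegral_likelihoodRatio_le_one ν F m m' hV hJ) l hT
  exact ENNReal.toReal_le_of_le_ofReal (inv_nonneg.2 hT.le) h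

/-- The number of values that are typical given the side information is bounded. -/
theorem card_posterior_le {l : ℕ} [Countable B] (w : Fin l → ∀ i, α i) (V : Finset (Fin N))
    (p : Measure (∀ i, α i)) [IsProbabilityMeasure p]
    (S : Finset (Fin l → B)) {s : ℝ} (hs : 0 < s)
    (hS : ∀ x ∈ S, s⁻¹ ≤ ∏ t, posterior p F V (w t) (x t)) : (S.card : ℝ) ≤ s := by
  let _ : MeasurableSpace B := ⊤
  have : MeasurableSingletonClass B := ⟨fun _ => trivial⟩
  have hF : Measurable F := measurable_of_countable _
  -- The posteriors are point masses of these laws. Conditioning on a null event gives the zero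
  -- measure, so the total mass is only known to be at most 1.
  set m : Fin l → Measure B := fun t => (p[|{a | ∀ i ∈ V, a i = w t i}]).map F with hm
  have h1 := card_mul_le_one_of_le_prod m (fun t => by
    rw [hm, Measure.map_apply hF MeasurableSet.univ]
    exact prob_le_one) S (c := s⁻¹) fun x hx => by
      refine (hS x hx).trans_eq (Finset.prod_congr rfl fun t _ => ?_)
      rw [hm, map_measureReal_apply hF (by simp), measureReal_def,
        cond_apply (Set.to_countable _).measurableSet, ENNReal.toReal_mul, ENNReal.toReal_inv,
        posterior, div_eq_inv_mul, letterProb, valueProb, measureReal_def, measureReal_def]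
      congr 3
      ext a
      simp [and_comm]
  rwa [← div_eq_mul_inv, div_le_one hs] at h1

end Codebook

/-! ### Decoding by tests and the error events. -/

section Coding

variable {N K : ℕ} (P : Problem N K)

/-- Decoding by tests: the code hashes the sequence `x m`, and receiver `j` looks for a sequence
that has the right hash value and passes the list test `T j` together with a message tuple that has
the right side information and passes the test `G j`. -/
theorem exists_code_of_tests {𝓧 : Type*} {M : Fin N → ℕ} (hM : ∀ i, 0 < M i) {n : ℕ} {χ : Type*}
    (x : (∀ i, Fin (M i)) → χ) (h : χ → Fin n → 𝓧) (T G : Fin K → (∀ i, Fin (M i)) → χ → Prop)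
    (hT : ∀ j m m' y, (∀ i ∈ P.A j, m i = m' i) → T j m y → T j m' y) :
    ∃ c : Code P 𝓧 M n, ∀ j m,
      (c.dec j (c.enc m) (fun i => m i.1) ≠ fun i : {i // i ∈ P.D j} => m i.1) →
      ((¬ T j m (x m) ∨ ¬ G j m (x m)) ∨
        ∃ m', (∀ i ∈ P.A j, m' i = m i) ∧ (∃ i ∈ P.D j, m' i ≠ m i) ∧ G j m' (x m)) ∨
      ∃ m', x m ≠ x m' ∧ T j m (x m') ∧ h (x m) = h (x m') := by
  classical
  -- `z.1` is the message estimate and `z.2` merely exhibits a possible sequence. Nothing requires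
  -- `x z.1 = x z.2`, since messages that are not demanded may be wrong.
  let Q (j : Fin K) (y : Fin n → 𝓧) (s : ∀ i : {i // i ∈ P.A j}, Fin (M i))
      (z : (∀ i, Fin (M i)) × (∀ i, Fin (M i))) : Prop :=
    (∀ i : {i // i ∈ P.A j}, z.1 i = s i) ∧ h (x z.2) = y ∧ T j z.1 (x z.2) ∧ G j z.1 (x z.2)
  refine ⟨⟨fun m => h (x m), fun j y s i => if hz : ∃ z, Q j y s z then hz.choose.1 i else
    ⟨0, hM i⟩⟩, fun j m herr => ?_⟩
  by_contra hcon
  push Not at hcon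
  obtain ⟨⟨⟨h1, h2⟩, h3⟩, h4⟩ := hcon
  have key (z : (∀ i, Fin (M i)) × (∀ i, Fin (M i))) (hz : Q j (h (x m)) (fun i => m i.1) z) :
      ∀ i ∈ P.D j, z.1 i = m i := by
    obtain ⟨e1, e2, e3, e4⟩ := hz
    -- The list test depends only on the side information, which `z.1` and `m` share; a different
    -- sequence would thus be an excluded collision.
    have hx : x m = x z.2 := by
      by_contra hne
      exact h4 _ hne (hT j _ m _ (fun i hi => e1 ⟨i, hi⟩) e3) e2.symm
    intro i hi
    by_contra hne
    refine h3 z.1 (fun i hi => e1 ⟨i, hi⟩) ⟨i, hi, hne⟩ ?_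
    rw [hx]
    exact e4
  apply herr
  have hz : ∃ z, Q j (h (x m)) (fun i => m i.1) z := ⟨(m, m), fun i => rfl, rfl, h1, h2⟩
  funext i
  simp only [dif_pos hz]
  exact key _ hz.choose_spec i i.2

/-- The number of colliding typical sequences under a good hash function is small. -/
theorem exists_hash_of_card_le {Y : Type*} [Fintype Y] [Nonempty Y] {I Ms χ : Type*} [Fintype I]
    [Fintype Ms] [DecidableEq Y] [DecidableEq χ] [DecidableEq I] (x : Ms → χ)
    (T : I → Ms → χ → Prop) {s : ℝ}
    (hlist : ∀ j m, ∀ S : Finset χ, (∀ y ∈ S, T j m y) → (S.card : ℝ) ≤ s) :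
    ∃ h : χ → Y, ∀ j, ∀ C : Finset Ms, (∀ m ∈ C, ∃ m', x m ≠ x m' ∧ T j m (x m') ∧
      h (x m) = h (x m')) →
      (C.card : ℝ) ≤ Fintype.card I * (s / Fintype.card Y) * Fintype.card Ms := by
  classical
  -- Potential collisions are collected for all receivers at once, so that one hash serves them all.
  set R : Finset (I × Ms × χ) := (Finset.univ ×ˢ Finset.univ ×ˢ Finset.univ.image x).filter
    fun r => x r.2.1 ≠ r.2.2 ∧ T r.1 r.2.1 r.2.2 with hR
  obtain ⟨h, hh⟩ := exists_hash (Y := Y) R (fun r => x r.2.1) (fun r => r.2.2)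
    fun r hr => (Finset.mem_filter.1 hr).2.1
  refine ⟨h, fun j C hC => ?_⟩
  have hRcard : (R.card : ℝ) ≤ Fintype.card I * Fintype.card Ms * s := by
    have h1 : R.card = ∑ z : I × Ms, ((Finset.univ.image x).filter
        fun y => x z.2 ≠ y ∧ T z.1 z.2 y).card := by
      rw [Fintype.sum_prod_type]
      simp only [hR, Finset.card_filter, Finset.sum_product]
    rw [h1, Nat.cast_sum]
    refine (Finset.sum_le_card_nsmul _ _ s fun z _ =>
      hlist z.1 z.2 _ fun y hy => (Finset.mem_filter.1 hy).2.2).trans_eq ?_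
    simp [nsmul_eq_mul]
  have hsub : C ⊆ (R.filter fun r => h (x r.2.1) = h r.2.2).image fun r => r.2.1 := by
    intro m hm
    obtain ⟨m', h1, h2, h3⟩ := hC m hm
    refine Finset.mem_image.2 ⟨(j, m, x m'), ?_, rfl⟩
    simp [R, h1, h2, h3]
  calc (C.card : ℝ) ≤ (R.filter fun r => h (x r.2.1) = h r.2.2).card := by
        exact_mod_cast (Finset.card_le_card hsub).trans Finset.card_image_le
    _ ≤ R.card / Fintype.card Y := hh
    _ ≤ (Fintype.card I * Fintype.card Ms * s) / Fintype.card Y := by gcongr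
    _ = _ := by ring

/-- The sets of messages that a wrong estimate of receiver `j`, who decodes the messages indexed by
`L j`, may confuse. -/
def confusable (L : Fin K → Finset (Fin N)) (j : Fin K) : Finset (Finset (Fin N)) :=
  (L j).powerset.filter fun J => (P.D j ∩ J).Nonempty

variable {α : Fin N → Type*} [∀ i, MeasurableSpace (α i)] (ν : ∀ i, Measure (α i))
  [∀ i, IsProbabilityMeasure (ν i)] {B : Type*} (F : (∀ i, α i) → B)

/-- The probability that some test fails for the transmitted messages. -/
noncomputable def atypicalProb (L : Fin K → Finset (Fin N)) (s : ℝ)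
    (T : Fin K → Finset (Fin N) → ℝ) (l : ℕ) (j : Fin K) : ℝ :=
  (Measure.infinitePi fun _ : Fin l => Measure.infinitePi ν).real
      {w | ¬ s⁻¹ ≤ ∏ t, posterior (Measure.infinitePi ν) F (P.A j) (w t) (F (w t))} +
    ∑ J ∈ confusable P L j, (Measure.infinitePi fun _ : Fin l => Measure.infinitePi ν).real
      {w | ¬ T j J ≤ ∏ t, likelihoodRatio (Measure.infinitePi ν) F J (P.A j ∪ (L j \ J)) (w t)
        (F (w t))}

/-- The sequence of composite indices of a message tuple. -/
def indexSeq {M : Fin N → ℕ} {l : ℕ} (c : Fin l → ∀ k : (i : Fin N) × Fin (M i), α k.1)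
    (m : ∀ i, Fin (M i)) : Fin l → B :=
  fun t => F (codewords c m t)

/-- The index sequence `x` is typical given the side information of receiver `j`. -/
def ListTest {M : Fin N → ℕ} {l : ℕ} (c : Fin l → ∀ k : (i : Fin N) × Fin (M i), α k.1) (s : ℝ)
    (j : Fin K) (m : ∀ i, Fin (M i)) (x : Fin l → B) : Prop :=
  s⁻¹ ≤ ∏ t, posterior (Measure.infinitePi ν) F (P.A j) (codewords c m t) (x t)

/-- The messages `m` are jointly typical with the index sequence `x` for receiver `j`. -/
def MessageTest {M : Fin N → ℕ} {l : ℕ} (c : Fin l → ∀ k : (i : Fin N) × Fin (M i), α k.1)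
    (L : Fin K → Finset (Fin N)) (T : Fin K → Finset (Fin N) → ℝ)
    (j : Fin K) (m : ∀ i, Fin (M i)) (x : Fin l → B) : Prop :=
  ∀ J ∈ confusable P L j,
    T j J ≤ ∏ t, likelihoodRatio (Measure.infinitePi ν) F J (P.A j ∪ (L j \ J)) (codewords c m t)
      (x t)

/-- The codebooks for which receiver `j` may fail on the messages `m` even if it knows the index
sequence. -/
def failure {M : Fin N → ℕ} {l : ℕ} (L : Fin K → Finset (Fin N)) (s : ℝ)
    (T : Fin K → Finset (Fin N) → ℝ) (j : Fin K) (m : ∀ i, Fin (M i)) :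
    Set (Fin l → ∀ k : (i : Fin N) × Fin (M i), α k.1) :=
  {c | (¬ ListTest P ν F c s j m (indexSeq F c m) ∨
      ¬ MessageTest P ν F c L T j m (indexSeq F c m)) ∨
    ∃ m', (∀ i ∈ P.A j, m' i = m i) ∧ (∃ i ∈ P.D j, m' i ≠ m i) ∧
      MessageTest P ν F c L T j m' (indexSeq F c m)}

variable [∀ i, Countable (α i)] [∀ i, MeasurableSingletonClass (α i)]

/-- The codewords of a fixed tuple are an i.i.d. sequence with the single-letter law, so a union
bound over the tests suffices. -/
theorem codebookLaw_atypical_le {M : Fin N → ℕ} (l : ℕ) (L : Fin K → Finset (Fin N)) (s : ℝ)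
    (T : Fin K → Finset (Fin N) → ℝ) (j : Fin K) (m : ∀ i, Fin (M i)) :
    (codebookLaw ν M l).real {c | ¬ ListTest P ν F c s j m (indexSeq F c m) ∨
      ¬ MessageTest P ν F c L T j m (indexSeq F c m)} ≤ atypicalProb P ν F L s T l j := by
  have hmeas : Measurable fun c : Fin l → ∀ k : (i : Fin N) × Fin (M i), α k.1 => codewords c m :=
    measurable_of_countable _
  unfold atypicalProb
  rw [← map_codewords_eq ν l m, map_measureReal_apply hmeas (Set.to_countable _).measurableSet]
  have hsub : {c : Fin l → ∀ k : (i : Fin N) × Fin (M i), α k.1 |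
      ¬ ListTest P ν F c s j m (indexSeq F c m) ∨
      ¬ MessageTest P ν F c L T j m (indexSeq F c m)} ⊆
      ((fun c => codewords c m) ⁻¹' {w | ¬ s⁻¹ ≤ ∏ t, posterior (Measure.infinitePi ν) F (P.A j)
        (w t) (F (w t))}) ∪ ⋃ J ∈ confusable P L j, ((fun c => codewords c m) ⁻¹'
        {w | ¬ T j J ≤ ∏ t, likelihoodRatio (Measure.infinitePi ν) F J (P.A j ∪ (L j \ J)) (w t)
        (F (w t))}) := by
    rintro c (hc | hc)
    · exact Or.inl hc
    · right
      simp only [MessageTest, not_forall] at hc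
      obtain ⟨J, hJ, hc⟩ := hc
      exact Set.mem_biUnion hJ hc
  refine (measureReal_mono hsub (measure_ne_top _ _)).trans ((measureReal_union_le _ _).trans ?_)
  refine add_le_add le_rfl ((measureReal_biUnion_finset_le _ _).trans_eq ?_)
  refine Finset.sum_congr rfl fun J _ => ?_
  rw [map_measureReal_apply hmeas (Set.to_countable _).measurableSet]

variable [Countable B]

/-- Union bound over the set `J` of messages in `L j` that are wrong. Messages outside `L j ∪ P.A j`
enter no test, so `m'` may be replaced by the truth off `J`, and only the choices on `J` are
counted. -/
theorem codebookLaw_wrong_le {M : Fin N → ℕ} (l : ℕ) (L : Fin K → Finset (Fin N))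
    (hDL : ∀ j, P.D j ⊆ L j) (hLA : ∀ j, Disjoint (L j) (P.A j))
    (T : Fin K → Finset (Fin N) → ℝ) (hT : ∀ j J, 0 < T j J) (j : Fin K) (m : ∀ i, Fin (M i)) :
    (codebookLaw ν M l).real {c | ∃ m', (∀ i ∈ P.A j, m' i = m i) ∧ (∃ i ∈ P.D j, m' i ≠ m i) ∧
      MessageTest P ν F c L T j m' (indexSeq F c m)} ≤
      ∑ J ∈ confusable P L j, (∏ i ∈ J, (M i : ℝ)) * (T j J)⁻¹ := by
  classical
  let sub (J : Finset (Fin N)) (w : ∀ i : J, Fin (M i)) : ∀ i, Fin (M i) :=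
    fun i => if hi : i ∈ J then w ⟨i, hi⟩ else m i
  let W (J : Finset (Fin N)) : Finset (∀ i : J, Fin (M i)) :=
    Finset.univ.filter fun w => ∀ i, w i ≠ m i
  have hsub : {c : Fin l → ∀ k : (i : Fin N) × Fin (M i), α k.1 |
      ∃ m', (∀ i ∈ P.A j, m' i = m i) ∧ (∃ i ∈ P.D j, m' i ≠ m i) ∧
      MessageTest P ν F c L T j m' (indexSeq F c m)} ⊆
      ⋃ J ∈ confusable P L j, ⋃ w ∈ W J, {c | T j J ≤ ∏ t, likelihoodRatio (Measure.infinitePi ν)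
        F J (P.A j ∪ (L j \ J)) (codewords c (sub J w) t) (F (codewords c m t))} := by
    rintro c ⟨m', hA, ⟨i₀, hi₀, hne⟩, htest⟩
    set J := (L j).filter fun i => m' i ≠ m i with hJdef
    have hJ : J ∈ confusable P L j := by
      rw [confusable, Finset.mem_filter, Finset.mem_powerset]
      exact ⟨Finset.filter_subset _ _, i₀,
        Finset.mem_inter.2 ⟨hi₀, Finset.mem_filter.2 ⟨hDL j hi₀, hne⟩⟩⟩
    refine Set.mem_biUnion hJ (Set.mem_biUnion (x := fun i : J => m' i) ?_ ?_)
    · simp only [W, Finset.coe_filter, Finset.mem_univ, true_and, Set.mem_ofPred_eq]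
      exact fun i => (Finset.mem_filter.1 i.2).2
    · refine (htest J hJ).trans_eq (Finset.prod_congr rfl fun t _ => ?_)
      refine likelihoodRatio_congr _ _ (fun i hi => ?_) _
      have hsub : sub J (fun i : J => m' i) i = m' i := by
        by_cases hiJ : i ∈ J
        · exact dif_pos hiJ
        · refine (dif_neg hiJ).trans ?_
          rcases Finset.mem_union.1 hi with h | h
          · exact absurd h hiJ
          · rcases Finset.mem_union.1 h with h | h
            · exact (hA i h).symm
            · by_contra hne
              exact hiJ (Finset.mem_filter.2 ⟨(Finset.mem_sdiff.1 h).1, fun h => hne h.symm⟩)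
      exact codewords_congr c hsub.symm t
  refine (measureReal_mono hsub (measure_ne_top _ _)).trans ((measureReal_biUnion_finset_le _ _).trans ?_)
  refine Finset.sum_le_sum fun J hJ => ?_
  rw [confusable, Finset.mem_filter, Finset.mem_powerset] at hJ
  refine (measureReal_biUnion_finset_le _ _).trans ?_
  have hcard : ((W J).card : ℝ) ≤ ∏ i ∈ J, (M i : ℝ) := by
    have h1 : (W J).card ≤ ∏ i : J, M i := by
      refine (Finset.card_le_univ _).trans_eq ?_
      simp [Fintype.card_pi]
    rw [Finset.prod_coe_sort J M] at h1
    exact_mod_cast h1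
  refine le_trans (Finset.sum_le_card_nsmul _ _ (T j J)⁻¹ fun w hw => ?_) ?_
  · refine codebookLaw_likelihoodRatio_ge_le ν F l m (sub J w) (fun i hi => ?_) (fun i hi => ?_)
      (hT j J)
    · have : i ∉ J := by
        rcases Finset.mem_union.1 hi with h | h
        · exact fun hiJ => Finset.disjoint_left.1 (hLA j) (hJ.1 hiJ) h
        · exact (Finset.mem_sdiff.1 h).2
      simp [sub, this]
    · have := (Finset.mem_filter.1 hw).2 ⟨i, hi⟩
      simpa [sub, hi] using this
  · rw [nsmul_eq_mul]
    exact mul_le_mul_of_nonneg_right hcard (inv_nonneg.2 (hT j J).le)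

/-- The probability that receiver `j` fails on given messages, if it knows the index sequence. -/
noncomputable def failureBound (M : Fin N → ℕ) (L : Fin K → Finset (Fin N)) (s : ℝ)
    (T : Fin K → Finset (Fin N) → ℝ) (l : ℕ) (j : Fin K) : ℝ :=
  atypicalProb P ν F L s T l j + ∑ J ∈ confusable P L j, (∏ i ∈ J, (M i : ℝ)) * (T j J)⁻¹

end Coding

/-! ### The random coding bound at a fixed block length. -/

section Coding

variable {N K : ℕ} (P : Problem N K)

variable {α : Fin N → Type*} [∀ i, MeasurableSpace (α i)] (ν : ∀ i, Measure (α i))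
  [∀ i, IsProbabilityMeasure (ν i)] {B : Type*} (F : (∀ i, α i) → B)
  [∀ i, Countable (α i)] [∀ i, MeasurableSingletonClass (α i)] [Countable B]

/-- Random coding at a fixed block length: composite index sequences of length `l` are hashed to
`n` channel symbols. -/
theorem exists_code_receiverError_le {𝓧 : Type*} [Fintype 𝓧] [Nonempty 𝓧] {M : Fin N → ℕ}
    (hM : ∀ i, 0 < M i) (n l : ℕ) (L : Fin K → Finset (Fin N))
    (hDL : ∀ j, P.D j ⊆ L j) (hLA : ∀ j, Disjoint (L j) (P.A j)) {s : ℝ} (hs : 0 < s)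
    (T : Fin K → Finset (Fin N) → ℝ) (hT : ∀ j J, 0 < T j J) :
    ∃ c : Code P 𝓧 M n, ∀ j, c.receiverError j ≤
      (∑ j, failureBound P ν F M L s T l j) + K * (s / (Fintype.card 𝓧 : ℝ) ^ n) := by
  classical
  obtain ⟨c, hc⟩ := exists_card_filter_le_sum_measureReal (codebookLaw ν M l)
    (Finset.univ : Finset (Fin K × ∀ i, Fin (M i))) (fun r => failure P ν F L s T r.1 r.2)
    fun r => (Set.to_countable _).measurableSet
  -- Failures are counted over pairs of receiver and message tuple, so the one codebook is good for
  -- every receiver.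
  set E := Finset.univ.filter fun r : Fin K × (∀ i, Fin (M i)) =>
    c ∈ failure P ν F L s T r.1 r.2 with hE
  have hEcard : (E.card : ℝ) ≤
      (∑ j, failureBound P ν F M L s T l j) * Fintype.card (∀ i, Fin (M i)) := by
    refine hc.trans ((Finset.sum_le_sum (g := fun r => failureBound P ν F M L s T l r.1)
      fun r _ => (measureReal_union_le _ _).trans (add_le_add
      (codebookLaw_atypical_le P ν F l L s T r.1 r.2)
      (codebookLaw_wrong_le P ν F l L hDL hLA T hT r.1 r.2))).trans_eq ?_)
    rw [Fintype.sum_prod_type, Finset.sum_mul]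
    simp only [Finset.sum_const, nsmul_eq_mul, Finset.card_univ]
    exact Finset.sum_congr rfl fun j _ => mul_comm _ _
  obtain ⟨h, hh⟩ := exists_hash_of_card_le (Y := Fin n → 𝓧) (indexSeq F c) (ListTest P ν F c s)
    fun j m S hS => card_posterior_le F (codewords c m) (P.A j) (Measure.infinitePi ν) S hs hS
  obtain ⟨code, hcode⟩ := exists_code_of_tests P hM (indexSeq F c) h (ListTest P ν F c s)
    (MessageTest P ν F c L T) (fun j m m' y hmm' h => by
      refine h.trans_eq (Finset.prod_congr rfl fun t _ => posterior_congr _ _ (fun i hi => ?_) _)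
      exact codewords_congr c (hmm' i hi) t)
  refine ⟨code, fun j => ?_⟩
  have hpos : (0 : ℝ) < Fintype.card (∀ i, Fin (M i)) := by
    have : Nonempty (∀ i, Fin (M i)) := ⟨fun i => ⟨0, hM i⟩⟩
    exact_mod_cast Fintype.card_pos
  rw [Code.receiverError, div_le_iff₀ hpos]
  set C : Finset (∀ i, Fin (M i)) := Finset.univ.filter fun m => ∃ m',
    indexSeq F c m ≠ indexSeq F c m' ∧ ListTest P ν F c s j m (indexSeq F c m') ∧
      h (indexSeq F c m) = h (indexSeq F c m') with hC
  have hCcard := hh j C fun m hm => (Finset.mem_filter.1 hm).2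
  rw [Fintype.card_fun, Fintype.card_fin, Fintype.card_fin, Nat.cast_pow] at hCcard
  have hsub (W : Finset (∀ i, Fin (M i))) (hW : ∀ m ∈ W,
      code.dec j (code.enc m) (fun i => m i.1) ≠ fun i : {i // i ∈ P.D j} => m i.1) :
      W ⊆ E.image Prod.snd ∪ C := by
    intro m hm
    rcases hcode j m (hW m hm) with h1 | h1
    · exact Finset.mem_union_left _ (Finset.mem_image.2
        ⟨(j, m), Finset.mem_filter.2 ⟨Finset.mem_univ _, h1⟩, rfl⟩)
    · exact Finset.mem_union_right _ (Finset.mem_filter.2 ⟨Finset.mem_univ _, h1⟩)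
  have hcard (W : Finset (∀ i, Fin (M i))) (hW : ∀ m ∈ W,
      code.dec j (code.enc m) (fun i => m i.1) ≠ fun i : {i // i ∈ P.D j} => m i.1) :
      (W.card : ℝ) ≤ E.card + C.card := by
    exact_mod_cast (Finset.card_le_card (hsub W hW)).trans ((Finset.card_union_le _ _).trans
      (add_le_add Finset.card_image_le le_rfl))
  refine (hcard _ fun m hm => (Finset.mem_filter.1 hm).2).trans ?_
  rw [add_mul]
  exact add_le_add hEcard hCcard

end Coding

/-! ### Choice of parameters and the limit. -/

section Asymptotics

theorem tendsto_const_mul_two_rpow_neg (C : ℝ) {κ : ℝ} (hκ : 0 < κ) :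
    Tendsto (fun n : ℕ => C * (2 : ℝ) ^ (-((n : ℝ) * κ))) atTop (𝓝 0) := by
  have h1 : Tendsto (fun n : ℕ => ((2 : ℝ) ^ (-κ)) ^ n) atTop (𝓝 0) :=
    tendsto_pow_atTop_nhds_zero_of_lt_one (by positivity)
      (Real.rpow_lt_one_of_one_lt_of_neg one_lt_two (by linarith))
  have h2 := h1.const_mul C
  rw [mul_zero] at h2
  refine h2.congr fun n => ?_
  rw [← Real.rpow_natCast, ← Real.rpow_mul (by norm_num)]
  congr 2
  ring

/-- Rounding up at most doubles a number that is at least 1; this is where nonnegative rates enter.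
-/
theorem prod_ceil_two_rpow_le {ι : Type*} (J : Finset ι) (R : ι → ℝ) (hR : ∀ i, 0 ≤ R i) (n : ℕ) :
    ∏ i ∈ J, ((⌈(2 : ℝ) ^ ((n : ℝ) * R i)⌉₊ : ℕ) : ℝ) ≤
      2 ^ J.card * (2 : ℝ) ^ ((n : ℝ) * ∑ i ∈ J, R i) := by
  calc ∏ i ∈ J, ((⌈(2 : ℝ) ^ ((n : ℝ) * R i)⌉₊ : ℕ) : ℝ)
      ≤ ∏ i ∈ J, (2 * (2 : ℝ) ^ ((n : ℝ) * R i)) := by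
        refine Finset.prod_le_prod (fun _ _ => Nat.cast_nonneg _) fun i _ => ?_
        have h1 : (1 : ℝ) ≤ 2 ^ ((n : ℝ) * R i) :=
          Real.one_le_rpow one_le_two (mul_nonneg (Nat.cast_nonneg _) (hR i))
        have h2 := Nat.ceil_lt_add_one (zero_le_one.trans h1)
        linarith
    _ = _ := by
        rw [Finset.prod_mul_distrib, Finset.prod_const, Finset.mul_sum,
          Real.rpow_sum_of_pos two_pos]

variable {N K : ℕ} (P : Problem N K) {α : Fin N → Type*} [∀ i, MeasurableSpace (α i)]
  (ν : ∀ i, Measure (α i)) {B : Type*} (F : (∀ i, α i) → B)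

theorem atypicalProb_nonneg (L : Fin K → Finset (Fin N)) (s : ℝ) (T : Fin K → Finset (Fin N) → ℝ)
    (l : ℕ) (j : Fin K) : 0 ≤ atypicalProb P ν F L s T l j :=
  add_nonneg measureReal_nonneg (Finset.sum_nonneg fun _ _ => measureReal_nonneg)

theorem failureBound_nonneg (M : Fin N → ℕ) (L : Fin K → Finset (Fin N)) (s : ℝ)
    {T : Fin K → Finset (Fin N) → ℝ} (hT : ∀ j J, 0 < T j J)
    (l : ℕ) (j : Fin K) : 0 ≤ failureBound P ν F M L s T l j :=
  add_nonneg (atypicalProb_nonneg ..) (Finset.sum_nonneg fun J _ =>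
    mul_nonneg (Finset.prod_nonneg fun _ _ => Nat.cast_nonneg _) (inv_nonneg.2 (hT j J).le))

variable [∀ i, IsProbabilityMeasure (ν i)] [∀ i, Countable (α i)]
  [∀ i, MeasurableSingletonClass (α i)]

theorem tendsto_atypicalProb (L : Fin K → Finset (Fin N)) (j : Fin K) {h : ℝ}
    (c : Fin K → Finset (Fin N) → ℝ)
    (hint : Integrable (fun a => Real.logb 2 (posterior (Measure.infinitePi ν) F (P.A j) a (F a)))
      (Measure.infinitePi ν))
    (hh : -h < ∫ a, Real.logb 2 (posterior (Measure.infinitePi ν) F (P.A j) a (F a))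
      ∂Measure.infinitePi ν)
    (hc : ∀ J ∈ confusable P L j,
      Integrable (fun a => Real.logb 2 (likelihoodRatio (Measure.infinitePi ν) F J
        (P.A j ∪ (L j \ J)) a (F a))) (Measure.infinitePi ν) ∧
      c j J < ∫ a, Real.logb 2 (likelihoodRatio (Measure.infinitePi ν) F J
        (P.A j ∪ (L j \ J)) a (F a)) ∂Measure.infinitePi ν) :
    Tendsto (fun l : ℕ => atypicalProb P ν F L ((2 : ℝ) ^ ((l : ℝ) * h))
      (fun j J => (2 : ℝ) ^ ((l : ℝ) * c j J)) l j) atTop (𝓝 0) := by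
  have h1 := tendsto_infinitePi_prod_lt (Measure.infinitePi ν)
    (fun a ha => posterior_pos (Measure.infinitePi ν) F ha (P.A j)) hint hh
  have h2 := tendsto_finsetSum (confusable P L j) fun J hJ =>
    tendsto_infinitePi_prod_lt (Measure.infinitePi ν)
    (fun a ha => likelihoodRatio_pos (Measure.infinitePi ν) F ha J (P.A j ∪ (L j \ J))) (hc J hJ).1
    (hc J hJ).2
  have h3 := h1.add h2
  rw [Finset.sum_const_zero, add_zero] at h3
  refine h3.congr fun l => ?_
  simp only [atypicalProb, mul_neg, Real.rpow_neg zero_le_two]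

/-- Composite coding at positive link capacity, with the single-letter conditions stated as
expectations of log-likelihoods. -/
theorem achievable_of_integral_lt [Countable B] {𝓧 : Type*} [Fintype 𝓧] [Nonempty 𝓧]
    (hcard : 1 < Fintype.card 𝓧) {R : Fin N → ℝ} (hR : ∀ i, 0 ≤ R i) (L : Fin K → Finset (Fin N))
    (hDL : ∀ j, P.D j ⊆ L j) (hLA : ∀ j, Disjoint (L j) (P.A j))
    (hpost : ∀ j, Integrable (fun a => Real.logb 2 (posterior (Measure.infinitePi ν) F (P.A j) a
        (F a))) (Measure.infinitePi ν) ∧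
      -Real.logb 2 (Fintype.card 𝓧) ≤ ∫ a, Real.logb 2 (posterior (Measure.infinitePi ν) F (P.A j) a
        (F a)) ∂Measure.infinitePi ν)
    (hratio : ∀ j, ∀ J ∈ confusable P L j,
      Integrable (fun a => Real.logb 2 (likelihoodRatio (Measure.infinitePi ν) F J
        (P.A j ∪ (L j \ J)) a (F a))) (Measure.infinitePi ν) ∧
      ∑ i ∈ J, R i < ∫ a, Real.logb 2 (likelihoodRatio (Measure.infinitePi ν) F J
        (P.A j ∪ (L j \ J)) a (F a)) ∂Measure.infinitePi ν) :
    Achievable P 𝓧 R := by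
  set C : ℝ := Real.logb 2 (Fintype.card 𝓧) with hC
  have hcard' : (1 : ℝ) < Fintype.card 𝓧 := by exact_mod_cast hcard
  have hC0 : 0 < C := Real.logb_pos one_lt_two hcard'
  have hpow : (Fintype.card 𝓧 : ℝ) = 2 ^ C :=
    (Real.rpow_logb two_pos (by norm_num) (by linarith)).symm
  -- Thresholds halfway between the sum rate and the information.
  set c : Fin K → Finset (Fin N) → ℝ := fun j J => (∑ i ∈ J, R i +
    ∫ a, Real.logb 2 (likelihoodRatio (Measure.infinitePi ν) F J
      (P.A j ∪ (L j \ J)) a (F a)) ∂Measure.infinitePi ν) / 2 with hc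
  have hRc (j) (J) (hJ : J ∈ confusable P L j) : ∑ i ∈ J, R i < c j J := by
    have := (hratio j J hJ).2
    simp only [hc]
    linarith
  obtain ⟨δ, hδ0, hδ1, hδ⟩ : ∃ δ : ℝ, 0 < δ ∧ δ < 1 ∧ ∀ j, ∀ J ∈ confusable P L j,
      ∑ i ∈ J, R i < (1 - δ) * c j J := by
    have h1 : ∀ᶠ δ : ℝ in 𝓝[>] 0, ∀ j, ∀ J ∈ confusable P L j,
        ∑ i ∈ J, R i < (1 - δ) * c j J := by
      refine eventually_all.2 fun j => (eventually_all_finset _).2 fun J hJ => ?_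
      have : Tendsto (fun δ : ℝ => (1 - δ) * c j J) (𝓝 0) (𝓝 ((1 - 0) * c j J)) :=
        Continuous.tendsto (by fun_prop) 0
      refine nhdsWithin_le_nhds (this.eventually_const_lt ?_)
      simpa using hRc j J hJ
    have h2 : ∀ᶠ δ : ℝ in 𝓝[>] 0, δ < 1 :=
      nhdsWithin_le_nhds (eventually_lt_nhds one_pos)
    obtain ⟨δ, h⟩ := (h1.and (h2.and self_mem_nhdsWithin)).exists
    exact ⟨δ, h.2.2, h.2.1, h.1⟩
  set l : ℕ → ℕ := fun n => ⌊(1 - δ) * n⌋₊ with hl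
  have hl_le (n : ℕ) : (l n : ℝ) ≤ (1 - δ) * n :=
    Nat.floor_le (mul_nonneg (by linarith) (Nat.cast_nonneg _))
  have hl_ge (n : ℕ) : (1 - δ) * n - 1 ≤ l n := (Nat.sub_one_lt_floor _).le
  have hl_top : Tendsto l atTop atTop :=
    tendsto_nat_floor_atTop.comp (tendsto_natCast_atTop_atTop.const_mul_atTop (by linarith))
  set M : ℕ → Fin N → ℕ := fun n i => ⌈(2 : ℝ) ^ ((n : ℝ) * R i)⌉₊ with hM
  -- The exponent `(1 + δ) * C` strictly exceeds the entropy bound, as the law of large numbers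
  -- needs, while `(1 - δ) * (1 + δ) = 1 - δ ^ 2` leaves the hash an exponential margin.
  set s : ℕ → ℝ := fun l => (2 : ℝ) ^ ((l : ℝ) * ((1 + δ) * C)) with hs
  set T : ℕ → Fin K → Finset (Fin N) → ℝ := fun l j J => (2 : ℝ) ^ ((l : ℝ) * c j J) with hT
  have hT0 (l j J) : 0 < T l j J := Real.rpow_pos_of_pos two_pos _
  have hs0 (l) : 0 < s l := Real.rpow_pos_of_pos two_pos _
  choose code hcode using fun n : ℕ => exists_code_receiverError_le P ν F (𝓧 := 𝓧) (M := M n)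
    (fun i => Nat.ceil_pos.2 (Real.rpow_pos_of_pos two_pos _)) n (l n) L hDL hLA (hs0 (l n))
    (T (l n)) (hT0 (l n))
  refine ⟨code, ?_⟩
  have h_fail (j : Fin K) :
      Tendsto (fun n => failureBound P ν F (M n) L (s (l n)) (T (l n)) (l n) j) atTop (𝓝 0) := by
    have h1 := (tendsto_atypicalProb P ν F L j (h := (1 + δ) * C) c (hpost j).1
      (lt_of_lt_of_le (by nlinarith) (hpost j).2) fun J hJ => ⟨(hratio j J hJ).1, by
        have := (hratio j J hJ).2
        simp only [hc]
        linarith⟩).comp hl_top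
    have h2 := tendsto_finsetSum (confusable P L j) (f := fun J (n : ℕ) =>
      (∏ i ∈ J, (M n i : ℝ)) * (T (l n) j J)⁻¹) (a := fun _ => 0) (x := atTop) fun J hJ => by
        have hc0 : 0 ≤ c j J := (Finset.sum_nonneg fun i _ => hR i).trans (hRc j J hJ).le
        have hκ : 0 < (1 - δ) * c j J - ∑ i ∈ J, R i := sub_pos.2 (hδ j J hJ)
        refine squeeze_zero (fun n => by have := hT0 (l n) j J; positivity) (fun n => ?_)
          -- The factor `2 ^ J.card` pays for the ceilings in the message sizes, `2 ^ c j J` for the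
          -- floor in `l`.
          (tendsto_const_mul_two_rpow_neg (2 ^ J.card * 2 ^ c j J) hκ)
        have e1 : (T (l n) j J)⁻¹ ≤ (2 : ℝ) ^ (-(((1 - δ) * n - 1) * c j J)) := by
          simp only [hT]
          rw [← Real.rpow_neg zero_le_two]
          refine Real.rpow_le_rpow_of_exponent_le one_le_two ?_
          have := mul_le_mul_of_nonneg_right (hl_ge n) hc0
          linarith
        refine (mul_le_mul (prod_ceil_two_rpow_le J R hR n) e1 (inv_nonneg.2 (hT0 _ _ _).le)
          (by positivity)).trans_eq ?_
        rw [mul_assoc, mul_assoc, ← Real.rpow_add two_pos, ← Real.rpow_add two_pos]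
        congr 2
        ring
    have h3 := h1.add h2
    rw [Finset.sum_const_zero, add_zero] at h3
    exact h3
  have h_hash : Tendsto (fun n => (K : ℝ) * (s (l n) / (Fintype.card 𝓧 : ℝ) ^ n)) atTop
      (𝓝 0) := by
    refine squeeze_zero (fun n => by have := hs0 (l n); positivity) (fun n => ?_)
      (tendsto_const_mul_two_rpow_neg K (κ := δ ^ 2 * C) (by positivity))
    refine mul_le_mul_of_nonneg_left ?_ (Nat.cast_nonneg _)
    rw [hpow, ← Real.rpow_natCast, ← Real.rpow_mul zero_le_two, ← Real.rpow_sub two_pos]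
    refine Real.rpow_le_rpow_of_exponent_le one_le_two ?_
    have := mul_le_mul_of_nonneg_right (hl_le n) (show 0 ≤ (1 + δ) * C by positivity)
    linarith
  have h_bound := (tendsto_finsetSum Finset.univ fun j _ => h_fail j).add h_hash
  rw [Finset.sum_const_zero, add_zero] at h_bound
  -- Without receivers the supremum is 0 by convention, so the bound must also be shown nonnegative.
  refine squeeze_zero (fun n => Real.iSup_nonneg fun j => ?_) (fun n => Real.iSup_le (hcode n) ?_)
    h_bound
  · exact div_nonneg (Nat.cast_nonneg _) (Nat.cast_nonneg _)
  · have := hs0 (l n)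
    exact add_nonneg (Finset.sum_nonneg fun j _ => failureBound_nonneg P ν F _ L _ (hT0 (l n)) _ j)
      (by positivity)

end Asymptotics

/-! ### Composites determined by the side information. -/

section Degenerate

variable {N : ℕ} {α : Fin N → Type*} [∀ i, MeasurableSpace (α i)]
  (p : Measure (∀ i, α i)) [IsProbabilityMeasure p]
  {B : Type*} (F : (∀ i, α i) → B)

theorem valueProb_le_letterProb (V : Finset (Fin N)) (b : ∀ i, α i) (x : B) :
    valueProb p F V b x ≤ letterProb p V b :=
  measureReal_mono fun _ h => h.2

theorem posterior_le_one (V : Finset (Fin N)) (b : ∀ i, α i) (x : B) : posterior p F V b x ≤ 1 :=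
  div_le_one_of_le₀ (valueProb_le_letterProb ..) (letterProb_nonneg ..)

variable [∀ i, Countable (α i)] [∀ i, MeasurableSingletonClass (α i)]

/-- If the letters of `V` determine the value of `F`, so do those of every larger set. -/
theorem valueProb_eq_letterProb_of_subset {V W : Finset (Fin N)} (hVW : V ⊆ W) {b : ∀ i, α i}
    {x : B} (h : valueProb p F V b x = letterProb p V b) :
    valueProb p F W b x = letterProb p W b := by
  have hsplit (S : Finset (Fin N)) : valueProb p F S b x +
      p.real {a | F a ≠ x ∧ ∀ i ∈ S, a i = b i} = letterProb p S b := by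
    rw [valueProb, letterProb, ← measureReal_union
      (Set.disjoint_left.2 fun a h1 h2 => h2.1 h1.1) (Set.to_countable _).measurableSet]
    congr 1
    ext a
    simp only [Set.mem_union, Set.mem_ofPred_eq]
    tauto
  -- The mass of `F ≠ x` is zero on the event for `V`, hence on the smaller event for `W`.
  have h1 : p.real {a | F a ≠ x ∧ ∀ i ∈ W, a i = b i} ≤
      p.real {a | F a ≠ x ∧ ∀ i ∈ V, a i = b i} :=
    measureReal_mono fun a h => ⟨h.1, fun i hi => h.2 i (hVW hi)⟩
  have h2 := hsplit V
  have h3 := hsplit W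
  have h4 : 0 ≤ p.real {a | F a ≠ x ∧ ∀ i ∈ W, a i = b i} := measureReal_nonneg
  linarith

end Degenerate

/-! ### Passing from `Ω` to the law of the letters. -/

section Translation

variable {Ω A β γ δ : Type*} [MeasurableSpace Ω] [MeasurableSpace A] [Countable A]
  [MeasurableSingletonClass A] (μ : Measure Ω) {W : Ω → A}

theorem measureReal_map_setOf (hW : Measurable W) (q : A → Prop) :
    (μ.map W).real {a | q a} = μ.real {ω | q (W ω)} :=
  map_measureReal_apply hW (Set.to_countable _).measurableSet

theorem condEntropy_comp (hW : Measurable W) (X : A → β) (Y : A → γ) :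
    condEntropy μ (fun ω => X (W ω)) (fun ω => Y (W ω)) = condEntropy (μ.map W) X Y := by
  simp only [condEntropy, measureReal_map_setOf μ hW]

theorem condMutualInfo_comp (hW : Measurable W) (Z : A → δ) (X : A → β) (Y : A → γ) :
    condMutualInfo μ (fun ω => Z (W ω)) (fun ω => X (W ω)) (fun ω => Y (W ω)) =
      condMutualInfo (μ.map W) Z X Y := by
  simp only [condMutualInfo, measureReal_map_setOf μ hW]

end Translation

/-! ### Entropy and information as expected log-likelihoods. -/

section SingleLetter

variable {N : ℕ} {α : Fin N → Type*} [∀ i, MeasurableSpace (α i)] {B : Type*} (F : (∀ i, α i) → B)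

theorem restrict_eq_iff {α : Fin N → Type*} (V : Finset (Fin N)) (a b : ∀ i, α i) :
    ((fun i : {i // i ∈ V} => a i) = fun i : {i // i ∈ V} => b i) ↔ ∀ i ∈ V, a i = b i := by
  simp [funext_iff]

/-- The composites have arbitrary value types, while the coding argument needs a countable one;
restricting `F` to its range changes no probability. -/
theorem posterior_rangeFactorization (p : Measure (∀ i, α i)) (V : Finset (Fin N))
    (a b : ∀ i, α i) :
    posterior p (Set.rangeFactorization F) V b (Set.rangeFactorization F a) =
      posterior p F V b (F a) := by
  simp only [posterior, valueProb, Subtype.ext_iff, Set.rangeFactorization_coe]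

theorem likelihoodRatio_rangeFactorization (p : Measure (∀ i, α i)) (J V : Finset (Fin N))
    (a b : ∀ i, α i) :
    likelihoodRatio p (Set.rangeFactorization F) J V b (Set.rangeFactorization F a) =
      likelihoodRatio p F J V b (F a) := by
  simp only [likelihoodRatio, valueProb, Subtype.ext_iff, Set.rangeFactorization_coe]

variable [∀ i, MeasurableSingletonClass (α i)]

theorem letterProb_infinitePi (ν : ∀ i, Measure (α i)) [∀ i, IsProbabilityMeasure (ν i)]
    (V : Finset (Fin N)) (b : ∀ i, α i) :
    letterProb (Measure.infinitePi ν) V b = ∏ i ∈ V, (ν i).real {b i} := by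
  have h : {a : ∀ i, α i | ∀ i ∈ V, a i = b i} = Set.pi V fun i => {b i} := by
    ext a
    simp
  rw [letterProb, h, measureReal_def, Measure.infinitePi_pi _ fun i _ => by simp,
    ENNReal.toReal_prod]
  rfl

variable [∀ i, Countable (α i)]

/-- A bound on the conditional entropy of `F` given some letters as a bound on the expected
log-posterior. -/
theorem integral_logb_posterior_of_condEntropy_le (p : Measure (∀ i, α i)) [IsProbabilityMeasure p]
    (V : Finset (Fin N)) {C : ℝ} (hC : 0 ≤ C)
    (h : condEntropy p F (fun a (i : {i // i ∈ V}) => a i) ≤ ENNReal.ofReal C) :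
    Integrable (fun a => Real.logb 2 (posterior p F V a (F a))) p ∧
      -C ≤ ∫ a, Real.logb 2 (posterior p F V a (F a)) ∂p := by
  set T : (∀ i, α i) → B × (∀ i : {i // i ∈ V}, α i) := fun a => (F a, fun i => a i) with hT
  set Φ : B × (∀ i : {i // i ∈ V}, α i) → ℝ := fun t => Real.logb 2
    (p.real {a | (fun i : {i // i ∈ V} => a i) = t.2} /
      p.real {a | F a = t.1 ∧ (fun i : {i // i ∈ V} => a i) = t.2}) with hΦ
  have hset (t) : {a | T a = t} = {a | F a = t.1 ∧ (fun i : {i // i ∈ V} => a i) = t.2} := by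
    ext a
    simp [hT, Prod.ext_iff]
  have hterm (t) : 0 ≤ p.real {a | T a = t} * Φ t := by
    rcases eq_or_lt_of_le (measureReal_nonneg (μ := p) (s := {a | T a = t})) with h0 | h0
    · rw [← h0, zero_mul]
    · refine mul_nonneg h0.le (Real.logb_nonneg one_lt_two ?_)
      rw [hset] at h0
      rw [one_le_div h0]
      exact measureReal_mono fun a ha => ha.2
  have hent : ∑' t, ENNReal.ofReal (p.real {a | T a = t} * Φ t) ≤ ENNReal.ofReal C := by
    simp only [hset]
    exact h
  have hsum : Summable fun t => p.real {a | T a = t} * Φ t := by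
    have := ENNReal.summable_toReal (hent.trans_lt ENNReal.ofReal_lt_top).ne
    refine this.congr fun t => ENNReal.toReal_ofReal (hterm t)
  obtain ⟨h1, h2⟩ := integrable_and_integral_eq_tsum p T Φ hsum
  have hval (a) : Φ (T a) = -Real.logb 2 (posterior p F V a (F a)) := by
    rw [← Real.logb_inv, posterior, inv_div]
    simp only [hΦ, hT, restrict_eq_iff]
    rfl
  simp only [hval] at h1 h2
  refine ⟨by simpa using h1.neg, ?_⟩
  rw [← ENNReal.ofReal_tsum_of_nonneg hterm hsum, ← h2, integral_neg,
    ENNReal.ofReal_le_ofReal_iff hC] at hent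
  linarith

/-- A lower bound on the conditional mutual information between independent sets of letters as a
bound on the expected log-likelihood ratio. -/
theorem integral_logb_likelihoodRatio_of_lt_condMutualInfo (ν : ∀ i, Measure (α i))
    [∀ i, IsProbabilityMeasure (ν i)] {J V : Finset (Fin N)} (hJV : Disjoint J V) {r : ℝ}
    (hr : 0 ≤ r) (h : r < condMutualInfo (Measure.infinitePi ν) (fun a (i : {i // i ∈ J}) => a i) F
      (fun a (i : {i // i ∈ V}) => a i)) :
    Integrable (fun a => Real.logb 2 (likelihoodRatio (Measure.infinitePi ν) F J V a (F a)))
      (Measure.infinitePi ν) ∧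
      r < ∫ a, Real.logb 2 (likelihoodRatio (Measure.infinitePi ν) F J V a (F a))
        ∂Measure.infinitePi ν := by
  set p := Measure.infinitePi ν with hp
  set T : (∀ i, α i) → (∀ i : {i // i ∈ J}, α i) × B × (∀ i : {i // i ∈ V}, α i) :=
    fun a => (fun i => a i, F a, fun i => a i) with hT
  set Φ : (∀ i : {i // i ∈ J}, α i) × B × (∀ i : {i // i ∈ V}, α i) → ℝ := fun t => Real.logb 2
    (p.real {a | (fun i : {i // i ∈ J} => a i) = t.1 ∧ F a = t.2.1 ∧
        (fun i : {i // i ∈ V} => a i) = t.2.2} * p.real {a | (fun i : {i // i ∈ V} => a i) = t.2.2} /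
      (p.real {a | (fun i : {i // i ∈ J} => a i) = t.1 ∧ (fun i : {i // i ∈ V} => a i) = t.2.2} *
        p.real {a | F a = t.2.1 ∧ (fun i : {i // i ∈ V} => a i) = t.2.2})) with hΦ
  have hset (t) : {a | T a = t} = {a | (fun i : {i // i ∈ J} => a i) = t.1 ∧ F a = t.2.1 ∧
        (fun i : {i // i ∈ V} => a i) = t.2.2} := by
    ext a
    simp [hT, Prod.ext_iff]
  have hinfo : condMutualInfo p (fun a (i : {i // i ∈ J}) => a i) F
      (fun a (i : {i // i ∈ V}) => a i) = ∑' t, p.real {a | T a = t} * Φ t := by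
    simp only [hset]
    rfl
  rw [hinfo] at h
  -- A divergent series has the default value 0, which cannot exceed `r ≥ 0`.
  have hsum : Summable fun t => p.real {a | T a = t} * Φ t := by
    by_contra hn
    rw [tsum_eq_zero_of_not_summable hn] at h
    linarith
  obtain ⟨h1, h2⟩ := integrable_and_integral_eq_tsum p T Φ hsum
  have hval : ∀ᵐ a ∂p, Φ (T a) = Real.logb 2 (likelihoodRatio p F J V a (F a)) := by
    refine ae_iff_of_countable.2 fun a ha => ?_
    have hV := letterProb_pos p ha V
    have e1 : p.real {a' | (fun i : {i // i ∈ J} => a' i) = (fun i : {i // i ∈ J} => a i) ∧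
        F a' = F a ∧ (fun i : {i // i ∈ V} => a' i) = fun i : {i // i ∈ V} => a i} =
        valueProb p F (J ∪ V) a (F a) := by
      rw [valueProb]
      congr 1
      ext a'
      simp only [restrict_eq_iff, Set.mem_ofPred_eq, Finset.forall_mem_union]
      tauto
    have e2 : p.real {a' | (fun i : {i // i ∈ V} => a' i) = fun i : {i // i ∈ V} => a i} =
        letterProb p V a := by
      simp only [restrict_eq_iff, letterProb]
    -- Independence of the letters on `J` and `V` is what allows the likelihood ratio to use the
    -- unconditional probability of the letters on `J`.
    have e3 : p.real {a' | (fun i : {i // i ∈ J} => a' i) = (fun i : {i // i ∈ J} => a i) ∧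
        (fun i : {i // i ∈ V} => a' i) = fun i : {i // i ∈ V} => a i} =
        letterProb p J a * letterProb p V a := by
      rw [hp, letterProb_infinitePi, letterProb_infinitePi, ← Finset.prod_union hJV,
        ← letterProb_infinitePi, letterProb]
      simp only [restrict_eq_iff, Finset.forall_mem_union]
    have e4 : p.real {a' | F a' = F a ∧
        (fun i : {i // i ∈ V} => a' i) = fun i : {i // i ∈ V} => a i} =
        valueProb p F V a (F a) := by
      simp only [restrict_eq_iff, valueProb]
    simp only [hΦ, hT]
    rw [e1, e2, e3, e4, likelihoodRatio, mul_right_comm, mul_div_mul_right _ _ hV.ne']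
  refine ⟨h1.congr hval, ?_⟩
  rw [← integral_congr_ae hval, h2]
  exact h

/-- If `F` is almost surely determined by the letters of `V`, it carries no further information. -/
theorem integral_logb_likelihoodRatio_eq_zero (ν : ∀ i, Measure (α i))
    [∀ i, IsProbabilityMeasure (ν i)] {J V W : Finset (Fin N)} (hJV : Disjoint J V) (hWV : W ⊆ V)
    (hint : Integrable (fun a => Real.logb 2 (posterior (Measure.infinitePi ν) F W a (F a)))
      (Measure.infinitePi ν))
    (h : 0 ≤ ∫ a, Real.logb 2 (posterior (Measure.infinitePi ν) F W a (F a))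
      ∂Measure.infinitePi ν) :
    ∫ a, Real.logb 2 (likelihoodRatio (Measure.infinitePi ν) F J V a (F a))
      ∂Measure.infinitePi ν = 0 := by
  set p := Measure.infinitePi ν with hp
  have hle : 0 ≤ fun a => -Real.logb 2 (posterior p F W a (F a)) := fun a =>
    neg_nonneg.2 (Real.logb_nonpos one_lt_two (posterior_nonneg ..) (posterior_le_one ..))
  -- The log-posterior is never positive, so a nonnegative mean forces it to vanish almost surely.
  have h0 : ∫ a, -Real.logb 2 (posterior p F W a (F a)) ∂p = 0 := by
    refine le_antisymm ?_ (integral_nonneg hle)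
    rw [integral_neg]
    linarith
  have hae := (integral_eq_zero_iff_of_nonneg hle hint.neg).1 h0
  refine integral_eq_zero_of_ae ?_
  refine ae_iff_of_countable.2 fun a ha => ?_
  have h1 : -Real.logb 2 (posterior p F W a (F a)) = 0 := ae_iff_of_countable.1 hae a ha
  have hpos := posterior_pos p F ha W
  have h2 : posterior p F W a (F a) = 1 := by
    rw [neg_eq_zero, Real.logb_eq_zero] at h1
    rcases h1 with h | h | h | h | h | h <;> linarith
  have h3 : valueProb p F W a (F a) = letterProb p W a :=
    (div_eq_one_iff_eq (letterProb_pos p ha W).ne').1 h2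
  have h4 : likelihoodRatio p F J V a (F a) = 1 := by
    rw [likelihoodRatio, valueProb_eq_letterProb_of_subset p F hWV h3,
      valueProb_eq_letterProb_of_subset p F (hWV.trans Finset.subset_union_right) h3, hp,
      letterProb_infinitePi, letterProb_infinitePi, letterProb_infinitePi,
      ← Finset.prod_union hJV, ← letterProb_infinitePi]
    exact div_self (letterProb_pos p ha _).ne'
  simp [h4]

end SingleLetter
end IndexCoding

/-! ### The main theorem. -/

theorem theorem2 {N K : ℕ} (P : IndexCoding.Problem N K)
    {𝓧 : Type*} [Fintype 𝓧] [Nonempty 𝓧]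
    -- the nonnegative rate tuple
    (R : Fin N → ℝ) (hR : ∀ i, 0 ≤ R i)
    -- independent discrete auxiliary random variables and the functions defining the composites
    {Ω : Type*} [MeasurableSpace Ω] (μ : Measure Ω) [IsProbabilityMeasure μ]
    {α : Fin N → Type*} [∀ i, Countable (α i)] [∀ i, MeasurableSpace (α i)]
    [∀ i, MeasurableSingletonClass (α i)]
    (U : ∀ i, Ω → α i) (hU : ∀ i, Measurable (U i)) (hindep : iIndepFun U μ)
    {β : Finset (Fin N) → Type*}
    (f : ∀ S : Finset (Fin N), (∀ i : {i // i ∈ S}, α i) → β S)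
    -- the rate of the composite indices
    (hH : ∀ j, IndexCoding.condEntropy μ (IndexCoding.composite U f)
        (IndexCoding.sub U (P.A j)) ≤ ENNReal.ofReal (Real.logb 2 (Fintype.card 𝓧 : ℝ)))
    -- the rates of the messages
    (hκ : ∀ j, ∃ Kj : Finset (Fin N), P.D j ⊆ Kj ∧ Kj ⊆ Finset.univ \ P.A j ∧
      ∀ J ⊆ Kj, (P.D j ∩ J).Nonempty →
        ∑ i ∈ J, R i < IndexCoding.condMutualInfo μ (IndexCoding.sub U J)
          (IndexCoding.composite U f) (IndexCoding.sub U (P.A j ∪ (Kj \ J)))) :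
    IndexCoding.Achievable P 𝓧 R := by
  open IndexCoding in
  choose L hDL hLA hI using hκ
  have hLA' (j : Fin K) : Disjoint (L j) (P.A j) :=
    Finset.disjoint_of_subset_left (hLA j) Finset.sdiff_disjoint
  set ν : ∀ i, Measure (α i) := fun i => μ.map (U i)
  have hν (i : Fin N) : IsProbabilityMeasure (ν i) :=
    Measure.isProbabilityMeasure_map (hU i).aemeasurable
  have hW : Measurable fun ω i => U i ω := measurable_pi_lambda _ hU
  have hlaw : μ.map (fun ω i => U i ω) = Measure.infinitePi ν :=
    hindep.map_fun_eq_infinitePi_map hU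
  set F : (∀ i, α i) → ∀ S, β S := fun a S => f S fun i => a i
  have hcard1 : 1 ≤ Fintype.card 𝓧 := Fintype.card_pos
  have hpost (j : Fin K) := integral_logb_posterior_of_condEntropy_le F (Measure.infinitePi ν)
    (P.A j) (C := Real.logb 2 (Fintype.card 𝓧))
    (Real.logb_nonneg one_lt_two (by exact_mod_cast hcard1)) (by
      rw [← hlaw, ← condEntropy_comp μ hW]
      exact hH j)
  have hdisj (j : Fin K) (J : Finset (Fin N)) (hJ : J ⊆ L j) : Disjoint J (P.A j ∪ (L j \ J)) :=
    Finset.disjoint_union_right.2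
      ⟨Finset.disjoint_of_subset_left hJ (hLA' j), Finset.disjoint_sdiff⟩
  have hratio (j : Fin K) (J : Finset (Fin N)) (hJ : J ⊆ L j) (hne : (P.D j ∩ J).Nonempty) :=
    integral_logb_likelihoodRatio_of_lt_condMutualInfo F ν (hdisj j J hJ)
      (Finset.sum_nonneg fun i _ => hR i) (by
        rw [← hlaw, ← condMutualInfo_comp μ hW]
        exact hI j J hJ hne)
  rcases hcard1.eq_or_lt with hone | hone
  -- With a single channel symbol the entropy bound is 0: side information determines the
  -- composites, the information for `J = P.D j` is 0, and the strict inequality fails. With no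
  -- receivers any code works.
  · rcases isEmpty_or_nonempty (Fin K) with hK | ⟨⟨j⟩⟩
    · refine ⟨fun n => ⟨fun _ _ => Classical.arbitrary 𝓧, fun j => (hK.false j).elim⟩, ?_⟩
      simp [Code.errorProb]
    · have hne : (P.D j ∩ P.D j).Nonempty := by
        rw [Finset.inter_self]
        exact P.D_nonempty j
      have h1 := (hratio j (P.D j) (hDL j) hne).2
      have h2 := (hpost j).2
      rw [← hone, Nat.cast_one, Real.logb_one, neg_zero] at h2
      rw [integral_logb_likelihoodRatio_eq_zero F ν (hdisj j _ (hDL j))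
        Finset.subset_union_left (hpost j).1 h2] at h1
      exact absurd h1 (Finset.sum_nonneg fun i _ => hR i).not_gt
  · have : Countable (Set.range F) := (Set.countable_range F).to_subtype
    refine achievable_of_integral_lt P ν (Set.rangeFactorization F) hone hR L hDL hLA' ?_ ?_
    · intro j
      simp only [posterior_rangeFactorization]
      exact hpost j
    · intro j J hJ
      rw [confusable, Finset.mem_filter, Finset.mem_powerset] at hJ
      simp only [likelihoodRatio_rangeFactorization]
      exact hratio j J hJ.1 hJ.2
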